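/- **Setting.** Let $\mathcal K=\{\kappa=(\kappa_0,\kappa_1,\kappa_2,\kappa_3,\kappa_4)\in\mathbb C^5 : 2\kappa_0+\kappa_1+\kappa_2+\kappa_3+\kappa_4=1\}$. Let $C=(c_{ij})_{0\le i,j\le 4}$ be the Cartan matrix of type $D_4^{(1)}$ with central node $0$: $c_{ii}=2$, $c_{0i}=c_{i0}=-1$ for $1\le i\le 4$, and $c_{ij}=0$ for distinct $i,j\in\{1,2,3,4\}$. Let $W=\langle\sigma_0,\dots,\sigma_4\rangle$ be the affine Weyl group of type $D_4^{(1)}$ acting on $\mathcal K$, where $\sigma_i(\kappa)_j=\kappa_j-\kappa_i c_{ij}$. The reflecting hyperplanes of $W$ are the $W$-translates of the hyperplanes $\{\kappa_i=0\}$, $0\le i\le 4$. For a proper subset $I\subsetneq\{0,1,2,3,4\}$ put $L_I=\{\kappa\in\mathcal K:\kappa_i=0\ (i\in I)\}$, and let the stratum $\mathcal K_I$ be the set of all $W$-translates of those points of $L_I$ that lie on no reflecting hyperplane of $W$ except those containing $L_I$. Let $D_I$ be the subdiagram of the Dynkin diagram $D_4^{(1)}$ that has precisely the nodes in $I$. For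 $\kappa\in\mathcal K$ put $a_i=2\cos\pi\kappa_i$ $(i=1,2,3)$, $a_4=-2\cos\pi\kappa_4$, and $\theta=\mathrm{rh}(\kappa)=(\theta_1,\theta_2,\theta_3,\theta_4)$ with $$\theta_i=a_ia_4+a_ja_k\quad(\{i,j,k\}=\{1,2,3\}),\qquad \theta_4=a_1a_2a_3a_4+a_1^2+a_2^2+a_3^2+a_4^2-4 .$$ Let $\mathcal S(\theta)\subset\mathbb C^3$ be the affine cubic surface $$x_1x_2x_3+x_1^2+x_2^2+x_3^2-\theta_1x_1-\theta_2x_2-\theta_3x_3+\theta_4=0 .$$ A simple singularity of type $A_n$ $(n\ge 1)$, $D_n$ $(n\ge 4)$, $E_6$, $E_7$, $E_8$ is a surface germ analytically isomorphic to the germ at the origin of $x^2+y^2+z^{n+1}=0$, $x^2+y^2z+z^{n-1}=0$, $x^2+y^3+z^4=0$, $x^2+y^3+yz^3=0$, $x^2+y^3+z^5=0$, respectively. A surface has simple singularities of Dynkin type $D$ if its singular points are in bijection with the connected components of the diagram $D$ in such a way that each of them is a simple singularity whose type is that of the corresponding component. **Theorem 9.4 (Classification of Singularities).** For every nonempty proper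 subset $I$ of $\{0,1,2,3,4\}$ and every $\kappa\in\mathcal K_I$, the surface $\mathcal S(\theta)$ with $\theta=\mathrm{rh}(\kappa)$ has simple singularities of type $D_I$. For every such $I$ the diagram $D_I$ is of one of the types $$D_4,\quad A_3,\quad A_2,\quad A_1,\quad A_1^{\oplus 4},\quad A_1^{\oplus 3},\quad A_1^{\oplus 2},$$ and each of these seven types is the type of $D_I$ for some such $I$ with $\mathcal K_I\neq\emptyset$. -/

import Mathlib

open scoped Topology

namespace PainleveVI

/-! ### Exponents and the affine Weyl group of type `D₄⁽¹⁾` -/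

/-- The four-dimensional affine parameter space `𝒦` of exponents
`κ = (κ₀, κ₁, κ₂, κ₃, κ₄) ∈ ℂ⁵` with `2κ₀ + κ₁ + κ₂ + κ₃ + κ₄ = 1`. -/
def Exponents : Type :=
  {κ : Fin 5 → ℂ // 2 * κ 0 + κ 1 + κ 2 + κ 3 + κ 4 = 1}

/-- The coordinates `κ₀, …, κ₄` of an exponent. -/
instance : CoeFun Exponents (fun _ => Fin 5 → ℂ) := ⟨Subtype.val⟩

/-- The Cartan matrix of type `D₄⁽¹⁾`; the node `0` is the central one. -/
def cartanAffineD4 : Matrix (Fin 5) (Fin 5) ℤ :=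
  !![ 2, -1, -1, -1, -1;
     -1,  2,  0,  0,  0;
     -1,  0,  2,  0,  0;
     -1,  0,  0,  2,  0;
     -1,  0,  0,  0,  2]

/-- The formula `κ_j ↦ κ_j - κ_i c_{ij}` for the `i`-th basic reflection, on `ℂ⁵`. -/
def reflectionFun (i : Fin 5) (κ : Fin 5 → ℂ) : Fin 5 → ℂ :=
  fun j => κ j - κ i * (cartanAffineD4 i j : ℂ)

theorem reflectionFun_mem (i : Fin 5) (κ : Exponents) :
    2 * reflectionFun i κ 0 + reflectionFun i κ 1 + reflectionFun i κ 2 + reflectionFun i κ 3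
      + reflectionFun i κ 4 = 1 := by
  have h := κ.2
  fin_cases i <;> simp [reflectionFun, cartanAffineD4] <;> linear_combination h

theorem reflectionFun_involutive (i : Fin 5) (κ : Fin 5 → ℂ) :
    reflectionFun i (reflectionFun i κ) = κ := by
  have h : cartanAffineD4 i i = 2 := by fin_cases i <;> rfl
  funext j
  simp only [reflectionFun, h]
  push_cast
  ring

/-- The basic reflection `σ_i` of `𝒦`, i.e. the reflection in the hyperplane `κ_i = 0` that is
orthogonal for the inner product `k₁k₁' + k₂k₂' + k₃k₃' + k₄k₄'`. -/
def basicReflection (i : Fin 5) : Equiv.Perm Exponents where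
  toFun κ := ⟨reflectionFun i κ, reflectionFun_mem i κ⟩
  invFun κ := ⟨reflectionFun i κ, reflectionFun_mem i κ⟩
  left_inv κ := Subtype.ext (reflectionFun_involutive i κ)
  right_inv κ := Subtype.ext (reflectionFun_involutive i κ)

/-- The affine Weyl group `W = ⟨σ₀, σ₁, σ₂, σ₃, σ₄⟩` of type `D₄⁽¹⁾`, acting on `𝒦`. -/
def affineWeylGroup : Subgroup (Equiv.Perm Exponents) :=
  Subgroup.closure (Set.range basicReflection)

/-- The reflecting hyperplanes of the reflections in `W`. The reflections in `W` are the
conjugates of the basic ones, so these are the `W`-translates of the hyperplanes `κ_i = 0`. -/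
def IsReflectingHyperplane (H : Set Exponents) : Prop :=
  ∃ w ∈ affineWeylGroup, ∃ i : Fin 5, H = w '' {κ | κ i = 0}

/-- The flat `κ_i = 0` for all `i ∈ I`. -/
def flat (I : Finset (Fin 5)) : Set Exponents :=
  {κ | ∀ i ∈ I, κ i = 0}

/-- The stratum `𝒦_I`: all `W`-translates of the points of the flat `κ_i = 0 (i ∈ I)` that lie on
no reflecting hyperplane of `W` except those that contain the whole flat. -/
def stratum (I : Finset (Fin 5)) : Set Exponents :=
  {κ | ∃ w ∈ affineWeylGroup, ∃ κ' ∈ flat I,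
    (∀ H, IsReflectingHyperplane H → κ' ∈ H → flat I ⊆ H) ∧ κ = w κ'}

/-! ### The Riemann–Hilbert correspondence on parameters and the cubic surfaces -/

/-- The local monodromy data `a = (a₁, a₂, a₃, a₄)` of an exponent (indexed from `0`). -/
noncomputable def localMonodromy (κ : Exponents) : Fin 4 → ℂ :=
  ![2 * Complex.cos (Real.pi * κ 1), 2 * Complex.cos (Real.pi * κ 2),
    2 * Complex.cos (Real.pi * κ 3), -2 * Complex.cos (Real.pi * κ 4)]

/-- The coefficients `θ = (θ₁, θ₂, θ₃, θ₄)` of the cubic as functions of `a`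
(indexed from `0`). -/
def cubicCoeff (a : Fin 4 → ℂ) : Fin 4 → ℂ :=
  ![a 0 * a 3 + a 1 * a 2,
    a 1 * a 3 + a 0 * a 2,
    a 2 * a 3 + a 0 * a 1,
    a 0 * a 1 * a 2 * a 3 + a 0 ^ 2 + a 1 ^ 2 + a 2 ^ 2 + a 3 ^ 2 - 4]

/-- The Riemann–Hilbert correspondence in the parameter level, `rh : 𝒦 → Θ`. -/
noncomputable def rh (κ : Exponents) : Fin 4 → ℂ := cubicCoeff (localMonodromy κ)

/-- The cubic polynomial `f(x, θ)`; the affine cubic surface `𝒮(θ) ⊆ ℂ³` is its zero set. -/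
def cubic (θ : Fin 4 → ℂ) (x : Fin 3 → ℂ) : ℂ :=
  x 0 * x 1 * x 2 + x 0 ^ 2 + x 1 ^ 2 + x 2 ^ 2 - θ 0 * x 0 - θ 1 * x 1 - θ 2 * x 2 + θ 3

/-! ### Dynkin diagrams of type `ADE` and simple singularities -/

/-- The underlying graph of the Dynkin diagram of a Cartan matrix. All Cartan matrices used here
are simply laced, so that the graph is the whole diagram. -/
def dynkinGraph {ι : Type} (M : Matrix ι ι ℤ) : SimpleGraph ι :=
  SimpleGraph.fromRel fun i j => M i j ≠ 0

/-- The subdiagram `D_I` of `D₄⁽¹⁾` that has precisely the nodes in `I`. -/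
def subdiagram (I : Finset (Fin 5)) : SimpleGraph (I : Set (Fin 5)) :=
  (dynkinGraph cartanAffineD4).induce (I : Set (Fin 5))

/-- The connected simply laced Dynkin types `A_n (n ≥ 1)`, `D_n (n ≥ 4)`, `E₆`, `E₇`, `E₈`. -/
inductive ADE : Type
  | A (n : ℕ) (hn : 1 ≤ n)
  | D (n : ℕ) (hn : 4 ≤ n)
  | E6
  | E7
  | E8

/-- The number of nodes of a Dynkin diagram. -/
def ADE.rank : ADE → ℕ
  | .A n _ => n
  | .D n _ => n
  | .E6 => 6
  | .E7 => 7
  | .E8 => 8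

/-- The Dynkin diagram of a given type. -/
def ADE.diagram : (T : ADE) → SimpleGraph (Fin T.rank)
  | .A n _ => dynkinGraph (CartanMatrix.A n)
  | .D n _ => dynkinGraph (CartanMatrix.D n)
  | .E6 => dynkinGraph CartanMatrix.E₆
  | .E7 => dynkinGraph CartanMatrix.E₇
  | .E8 => dynkinGraph CartanMatrix.E₈

/-- The normal form, in three variables, of the simple singularity of a given type. -/
def ADE.normalForm : ADE → (Fin 3 → ℂ) → ℂ
  | .A n _, y => y 0 ^ 2 + y 1 ^ 2 + y 2 ^ (n + 1)
  | .D n _, y => y 0 ^ 2 + y 1 ^ 2 * y 2 + y 2 ^ (n - 1)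
  | .E6, y => y 0 ^ 2 + y 1 ^ 3 + y 2 ^ 4
  | .E7, y => y 0 ^ 2 + y 1 ^ 3 + y 1 * y 2 ^ 3
  | .E8, y => y 0 ^ 2 + y 1 ^ 3 + y 2 ^ 5

/-- `p` is a singular point of the surface `f = 0`. -/
def IsSingularPoint (f : (Fin 3 → ℂ) → ℂ) (p : Fin 3 → ℂ) : Prop :=
  f p = 0 ∧ fderiv ℂ f p = 0

/-- The surface `f = 0` has at `p` a simple singularity of type `T`: its germ at `p` is isomorphic
to the germ at `0` of the hypersurface given by the normal form of type `T`. That is, in suitable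
local analytic coordinates `φ` around `p`, the two equations agree up to a unit `u`. -/
def HasSimpleSingularityAt (f : (Fin 3 → ℂ) → ℂ) (p : Fin 3 → ℂ) (T : ADE) : Prop :=
  ∃ (φ : (Fin 3 → ℂ) → (Fin 3 → ℂ)) (u : (Fin 3 → ℂ) → ℂ),
    AnalyticAt ℂ φ 0 ∧ φ 0 = p ∧ Function.Bijective (fderiv ℂ φ 0) ∧
    AnalyticAt ℂ u 0 ∧ u 0 ≠ 0 ∧
    ∀ᶠ y in 𝓝 (0 : Fin 3 → ℂ), f (φ y) = u y * T.normalForm y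

/-- The surface `f = 0` has simple singularities of Dynkin type `Γ`: its singular points correspond
bijectively to the connected components of `Γ`, and each of them is a simple singularity whose
type is that of the corresponding component. -/
def HasSimpleSingularitiesOfType (f : (Fin 3 → ℂ) → ℂ) {V : Type} (Γ : SimpleGraph V) : Prop :=
  ∃ e : Γ.ConnectedComponent ≃ {p : Fin 3 → ℂ // IsSingularPoint f p},
    ∀ c : Γ.ConnectedComponent, ∃ T : ADE,
      Nonempty (c.toSimpleGraph ≃g T.diagram) ∧ HasSimpleSingularityAt f (e c) T

/-- The graph `Γ` is the disjoint union of the Dynkin diagrams of the types listed in `l`. -/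
def HasDynkinType {V : Type} (Γ : SimpleGraph V) (l : List ADE) : Prop :=
  ∃ e : Γ.ConnectedComponent ≃ Fin l.length,
    ∀ c : Γ.ConnectedComponent, Nonempty (c.toSimpleGraph ≃g (l.get (e c)).diagram)

/-- The types `D₄`, `A₃`, `A₂`, `A₁`, `A₁^⊕4`, `A₁^⊕3`, `A₁^⊕2`. -/
def possibleTypes : List (List ADE) :=
  [[.D 4 le_rfl], [.A 3 (by norm_num)], [.A 2 (by norm_num)], [.A 1 le_rfl],
    List.replicate 4 (.A 1 le_rfl), List.replicate 3 (.A 1 le_rfl),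
    List.replicate 2 (.A 1 le_rfl)]

end PainleveVI

namespace PainleveVI

/-! ### Singular points of the cubic surfaces -/

/-! A point `p` is singular on the cubic exactly when `θ = cubicCoeff ![p 0, p 1, p 2, 2]`, so with
`θ = cubicCoeff a` finding singular points means comparing two quadruples in one fibre of
`cubicCoeff`. In the Fourier coordinates `u` of `a`, the differences `u i ^ 2 - u 0 ^ 2` and the
product of all `u i`, as a polynomial in `u 0 ^ 2`, depend on `θ` alone. Hence `u 0 ^ 2` is a root
of a cubic polynomial, which for such a `θ` has an explicit simple factor and an explicit squared
factor (`fourierCoord_dichotomy`). The first root gives `a l = ±2` for some `l` and a "scalar"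
point; the second gives eigenvalues `β i` of product one and a "reducible" point
(`eq_scalarPoint_or_eq_reduciblePoint`). The type of a singular point is read off from `hessianForm
p` and from which `p i` equal `±2`: `A₁` if the Hessian is nonzero; otherwise `A₂`, `A₃` or `D₄`
according to whether none, some but not all, or all of the `p i` are `±2`. Splitting off a square
leaves a quadratic form in two variables whose discriminant gives the `A_n` cases; for `D₄` it
splits into three factors. Since `rh` is constant on `W`-orbits, a generic point of the flat
suffices. Scalar points correspond to integral `κ i` at leaves, reducible ones to integral `κ 0 + ∑
x i * κ i.succ` with `x i ∈ {0, 1}`, and both conditions define reflecting hyperplanes. If `0 ∉ I`,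
genericity excludes reducible points and leaves one node for each leaf in `I`. If `0 ∈ I`, all
candidates merge into one reducible point, and the number of `β i = ±1` determines its type.
Matching diagrams is then counting, because a connected `D_I` is a star and any other one has no
edges. For nonemptiness of strata it suffices that reflecting hyperplanes have integral equations:
points whose free coordinates are rationally independent are generic. -/

theorem hasFDerivAt_cubic (θ : Fin 4 → ℂ) (p : Fin 3 → ℂ) :
    HasFDerivAt (cubic θ)
      ((p 1 * p 2 + 2 * p 0 - θ 0) • ContinuousLinearMap.proj (R := ℂ) (φ := fun _ : Fin 3 => ℂ) 0
        + (p 0 * p 2 + 2 * p 1 - θ 1) •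
          ContinuousLinearMap.proj (R := ℂ) (φ := fun _ : Fin 3 => ℂ) 1
        + (p 0 * p 1 + 2 * p 2 - θ 2) •
          ContinuousLinearMap.proj (R := ℂ) (φ := fun _ : Fin 3 => ℂ) 2) p := by
  have h (i : Fin 3) : HasFDerivAt (fun x : Fin 3 → ℂ => x i)
      (ContinuousLinearMap.proj (R := ℂ) (φ := fun _ : Fin 3 => ℂ) i) p := hasFDerivAt_apply i p
  have := ((((((((h 0).mul (h 1)).mul (h 2)).add ((h 0).pow 2)).add ((h 1).pow 2)).add
    ((h 2).pow 2)).sub ((h 0).const_mul (θ 0))).sub ((h 1).const_mul (θ 1))).sub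
    ((h 2).const_mul (θ 2)) |>.add_const (θ 3)
  refine HasFDerivAt.congr_fderiv this ?_
  ext v
  simp
  ring

/-- The vanishing partial derivatives determine the first three coefficients; substituting them in
the equation determines the last. Together the equations say `θ = cubicCoeff ![p 0, p 1, p 2, 2]`.
-/
theorem isSingularPoint_cubic_iff (θ : Fin 4 → ℂ) (p : Fin 3 → ℂ) :
    IsSingularPoint (cubic θ) p ↔
      θ 0 = p 1 * p 2 + 2 * p 0 ∧ θ 1 = p 0 * p 2 + 2 * p 1 ∧ θ 2 = p 0 * p 1 + 2 * p 2 ∧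
        θ 3 = 2 * (p 0 * p 1 * p 2) + p 0 ^ 2 + p 1 ^ 2 + p 2 ^ 2 := by
  rw [IsSingularPoint, (hasFDerivAt_cubic θ p).fderiv]
  constructor
  · rintro ⟨h0, h⟩
    have h1 := congrArg (fun L => L (Pi.single 0 1)) h
    have h2 := congrArg (fun L => L (Pi.single 1 1)) h
    have h3 := congrArg (fun L => L (Pi.single 2 1)) h
    simp at h1 h2 h3
    simp only [cubic] at h0
    refine ⟨by linear_combination -h1, by linear_combination -h2, by linear_combination -h3, ?_⟩
    linear_combination h0 - p 0 * h1 - p 1 * h2 - p 2 * h3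
  · rintro ⟨h0, h1, h2, h3⟩
    refine ⟨?_, ?_⟩
    · simp only [cubic, h0, h1, h2, h3]; ring
    · ext v
      simp [h0, h1, h2]

/-! ### Normal forms of the singular points -/

/-- Analytic functions have analytic square roots near points where they do not vanish. -/
theorem exists_analyticAt_sq_eq {E : Type*} [NormedAddCommGroup E] [NormedSpace ℂ E]
    {h : E → ℂ} {x : E} (hh : AnalyticAt ℂ h x) (hx : h x ≠ 0) :
    ∃ g : E → ℂ, AnalyticAt ℂ g x ∧ ∀ y, g y ^ 2 = h y := by
  -- Dividing by `h x` moves the value at `x` to 1, inside the slit plane where the principal root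
  -- is analytic.
  refine ⟨fun y => (h x) ^ (((2 : ℕ) : ℂ)⁻¹) * (h y / h x) ^ (((2 : ℕ) : ℂ)⁻¹), ?_, fun y => ?_⟩
  · refine analyticAt_const.mul (AnalyticAt.cpow (hh.div analyticAt_const hx) analyticAt_const ?_)
    simp [div_self hx, Complex.slitPlane]
  · rw [mul_pow, Complex.cpow_nat_inv_pow _ two_ne_zero, Complex.cpow_nat_inv_pow _ two_ne_zero]
    field_simp

/-- The Hessian determinant of the cubic at a singular point, up to a factor. -/
def hessianForm (p : Fin 3 → ℂ) : ℂ :=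
  p 0 * p 1 * p 2 - p 0 ^ 2 - p 1 ^ 2 - p 2 ^ 2 + 4

/-- The first stage of the construction of coordinates at a singular point of a cubic: after one
square is split off, it is left to bring a function of two variables to normal form. -/
theorem hasSimpleSingularityAt_of_splitting {θ : Fin 4 → ℂ} {p : Fin 3 → ℂ}
    (hp : IsSingularPoint (cubic θ) p) (T : ADE) {U Y Z u : (Fin 3 → ℂ) → ℂ}
    {U' Y' Z' : (Fin 3 → ℂ) →L[ℂ] ℂ}
    (hU : AnalyticAt ℂ U 0) (hY : AnalyticAt ℂ Y 0) (hZ : AnalyticAt ℂ Z 0)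
    (hu : AnalyticAt ℂ u 0) (hu0 : u 0 ≠ 0) (hU0 : U 0 = 0) (hY0 : Y 0 = 0) (hZ0 : Z 0 = 0)
    (hU' : HasFDerivAt U U' 0) (hY' : HasFDerivAt Y Y' 0) (hZ' : HasFDerivAt Z Z' 0)
    (hinj : ∀ v, U' v = 0 → Y' v = 0 → Z' v = 0 → v = 0)
    (h : ∀ᶠ y in 𝓝 0, U y ^ 2 - (((p 2 + Z y) ^ 2 - 4) * Y y ^ 2
      + 2 * (p 1 * (p 2 + Z y) - 2 * p 0) * Z y * Y y + (p 1 ^ 2 - 4) * Z y ^ 2) / 4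
        = u y * T.normalForm y) :
    HasSimpleSingularityAt (cubic θ) p T := by
  -- The subtracted half completes the square in the first variable: at a singular point the cubic
  -- is `X² + X (p₂Y + p₁Z + YZ) + Y² + Z² + p₀YZ` in the displacements `X`, `Y`, `Z`.
  have hX' : HasFDerivAt (fun y => p 0 + (U y - (p 2 * Y y + p 1 * Z y + Y y * Z y) / 2))
      (U' - (2 : ℂ)⁻¹ • (p 2 • Y' + p 1 • Z')) 0 := by
    have := (hU'.sub ((((hY'.const_mul (p 2)).add (hZ'.const_mul (p 1))).add
      (hY'.mul hZ')).mul_const (2⁻¹ : ℂ))).const_add (p 0)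
    simp only [div_eq_mul_inv]
    refine HasFDerivAt.congr_fderiv this ?_
    ext v
    simp [hY0, hZ0]
  have hφ' : HasFDerivAt (fun y => ![p 0 + (U y - (p 2 * Y y + p 1 * Z y + Y y * Z y) / 2),
      p 1 + Y y, p 2 + Z y])
      (ContinuousLinearMap.pi ![U' - (2 : ℂ)⁻¹ • (p 2 • Y' + p 1 • Z'), Y', Z']) 0 := by
    rw [hasFDerivAt_pi']
    intro i
    fin_cases i
    · exact hX'
    · exact hY'.const_add _
    · exact hZ'.const_add _
  refine ⟨fun y => ![p 0 + (U y - (p 2 * Y y + p 1 * Z y + Y y * Z y) / 2),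
      p 1 + Y y, p 2 + Z y], u, ?_, ?_, ?_, hu, hu0, ?_⟩
  · rw [analyticAt_pi_iff]
    intro i
    fin_cases i
    · exact analyticAt_const.add (hU.sub ((((analyticAt_const.mul hY).add
        (analyticAt_const.mul hZ)).add (hY.mul hZ)).div analyticAt_const two_ne_zero))
    · exact analyticAt_const.add hY
    · exact analyticAt_const.add hZ
  · ext i
    fin_cases i <;> simp [hU0, hY0, hZ0]
  · rw [hφ'.fderiv]
    have : Function.Injective (ContinuousLinearMap.pi (R := ℂ) (φ := fun _ : Fin 3 => ℂ)
        ![U' - (2 : ℂ)⁻¹ • (p 2 • Y' + p 1 • Z'), Y', Z'] : (Fin 3 → ℂ) →ₗ[ℂ] (Fin 3 → ℂ)) := by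
      rw [← LinearMap.ker_eq_bot, LinearMap.ker_eq_bot']
      intro v hv
      have h0 := congrFun hv 0
      have h1 := congrFun hv 1
      have h2 := congrFun hv 2
      simp at h0 h1 h2
      refine hinj v ?_ h1 h2
      simpa [h1, h2] using h0
    exact ⟨this, LinearMap.injective_iff_surjective.mp this⟩
  · obtain ⟨h0, h1, h2, h3⟩ := (isSingularPoint_cubic_iff θ p).mp hp
    filter_upwards [h] with y hy
    rw [← hy]
    simp only [cubic, h0, h1, h2, h3, Matrix.cons_val]
    ring

theorem hasFDerivAt_clm_mul {E : Type*} [NormedAddCommGroup E] [NormedSpace ℂ E]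
    (l : E →L[ℂ] ℂ) {s : E → ℂ} (hs : AnalyticAt ℂ s 0) :
    HasFDerivAt (fun y => l y * s y) (s 0 • l) 0 := by
  refine HasFDerivAt.congr_fderiv (l.hasFDerivAt (x := 0).mul hs.differentiableAt.hasFDerivAt) ?_
  ext v
  simp

/-- The `i`-th coordinate as a continuous linear functional. -/
noncomputable abbrev coord (i : Fin 3) : (Fin 3 → ℂ) →L[ℂ] ℂ :=
  ContinuousLinearMap.proj (R := ℂ) (φ := fun _ : Fin 3 => ℂ) i

theorem analyticAt_coord (i : Fin 3) (x : Fin 3 → ℂ) : AnalyticAt ℂ (fun y : Fin 3 → ℂ => y i) x :=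
  (coord i).analyticAt x

/-- The singular points of type `A_n`, when the quadratic form in the last two variables has
rank one or two and is not degenerate in the direction of the second one. -/
theorem hasSimpleSingularityAt_A {θ : Fin 4 → ℂ} {p : Fin 3 → ℂ}
    (hp : IsSingularPoint (cubic θ) p) (hp2 : p 2 ^ 2 ≠ 4) (n : ℕ) (hn : 1 ≤ n) (k : ℂ → ℂ)
    (hk : AnalyticAt ℂ k 0) (hk0 : k 0 ≠ 0)
    (h : ∀ z, -hessianForm p + z * (2 * p 2 - p 0 * p 1) + z ^ 2 = z ^ (n - 1) * k z) :
    HasSimpleSingularityAt (cubic θ) p (.A n hn) := by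
  set A : (Fin 3 → ℂ) → ℂ := fun y => (p 2 + y 2) ^ 2 - 4 with hA
  have hAa : AnalyticAt ℂ A 0 :=
    ((analyticAt_const.add (analyticAt_coord 2 0)).pow 2).sub analyticAt_const
  have hA0 : A 0 ≠ 0 := by simpa [hA, sub_eq_zero] using hp2
  have hka : AnalyticAt ℂ (fun y : Fin 3 → ℂ => k (y 2)) 0 :=
    AnalyticAt.fun_comp (f := fun y : Fin 3 → ℂ => y 2) hk (analyticAt_coord 2 0)
  obtain ⟨g, hg, hgk⟩ := exists_analyticAt_sq_eq hka (by simpa using hk0)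
  obtain ⟨r, hr, hrA⟩ := exists_analyticAt_sq_eq hAa hA0
  have hr0 : r 0 ≠ 0 := by
    intro h0; apply hA0; rw [← hrA, h0]; simp
  have hg0 : g 0 ≠ 0 := by
    intro h0; apply hk0; have := hgk 0; rw [h0] at this; simpa using this.symm
  have hs0 : AnalyticAt ℂ (fun y => g y / r y) 0 := hg.div hr hr0
  have hs1 : AnalyticAt ℂ (fun y => 2 * Complex.I * g y / A y) 0 :=
    (analyticAt_const.mul hg).div hAa hA0
  have hs2 : AnalyticAt ℂ (fun y : Fin 3 → ℂ => -(p 1 * (p 2 + y 2) - 2 * p 0) / A y) 0 :=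
    ((analyticAt_const.mul (analyticAt_const.add (analyticAt_coord 2 0))).sub
      analyticAt_const).neg.div hAa hA0
  -- `Y` completes the square in the remaining quadratic form, whose leading coefficient is `A`. A
  -- quarter of its discriminant is `4 z² z^(n-1) k z`, by `h`; the factors `g / r` and `2i g / A`
  -- then make all three terms share the unit `k / A`.
  refine hasSimpleSingularityAt_of_splitting hp _
    (U := fun y => y 0 * (g y / r y))
    (Y := fun y => y 1 * (2 * Complex.I * g y / A y)
      + y 2 * (-(p 1 * (p 2 + y 2) - 2 * p 0) / A y))
    (Z := fun y => y 2) (u := fun y => k (y 2) / A y)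
    ((analyticAt_coord 0 0).mul hs0)
    (((analyticAt_coord 1 0).mul hs1).add ((analyticAt_coord 2 0).mul hs2))
    (analyticAt_coord 2 0) (hka.div hAa hA0) (div_ne_zero (by simpa using hk0) hA0)
    (by simp) (by simp) (by simp)
    (hasFDerivAt_clm_mul (coord 0) hs0)
    ((hasFDerivAt_clm_mul (coord 1) hs1).add (hasFDerivAt_clm_mul (coord 2) hs2))
    (coord 2).hasFDerivAt ?_ ?_
  · intro v h0 h1 h2
    simp only [add_apply, smul_apply,
      ContinuousLinearMap.proj_apply, smul_eq_mul] at h0 h1 h2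
    have h0' := (mul_eq_zero.mp h0).resolve_left (div_ne_zero hg0 hr0)
    rw [h2, mul_zero, add_zero] at h1
    have h1' := (mul_eq_zero.mp h1).resolve_left
      (div_ne_zero (mul_ne_zero (mul_ne_zero two_ne_zero Complex.I_ne_zero) hg0) hA0)
    ext i
    fin_cases i <;> assumption
  · filter_upwards [hAa.continuousAt.eventually_ne hA0] with y hy
    have hry : r y ≠ 0 := by
      intro h0; apply hy; rw [← hrA, h0]; simp
    have e1 : (g y / r y) ^ 2 = k (y 2) / A y := by rw [div_pow, hgk, hrA]
    have e2 : (2 * Complex.I * g y / A y) ^ 2 = -4 * k (y 2) / A y ^ 2 := by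
      rw [div_pow, mul_pow, mul_pow, Complex.I_sq, hgk]; ring
    have e3 : y 2 ^ (n + 1) = y 2 ^ 2 * y 2 ^ (n - 1) := by
      rw [← pow_add]; congr 1; omega
    have hAy : (p 2 + y 2) ^ 2 - 4 = A y := rfl
    have e4 := h (y 2)
    simp only [ADE.normalForm, e3, hAy]
    rw [mul_pow, e1]
    generalize 2 * Complex.I * g y / A y = s at e2 ⊢
    have e5 : s ^ 2 * A y ^ 2 = -4 * k (y 2) := by rw [e2]; field_simp
    have : hessianForm p = p 0 * p 1 * p 2 - p 0 ^ 2 - p 1 ^ 2 - p 2 ^ 2 + 4 := rfl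
    rw [this] at e4
    field_simp
    linear_combination -(y 1) ^ 2 * e5 + 4 * (y 2) ^ 2 * e4

/-- The singular points at which all coordinates are `±2`, with Hessian of rank one. -/
theorem hasSimpleSingularityAt_D4 {θ : Fin 4 → ℂ} {p : Fin 3 → ℂ}
    (hp : IsSingularPoint (cubic θ) p) (h1 : p 1 ^ 2 = 4) (h2 : p 2 ^ 2 = 4)
    (h : p 1 * p 2 = 2 * p 0) :
    HasSimpleSingularityAt (cubic θ) p (.D 4 le_rfl) := by
  have hp1 : p 1 ≠ 0 := by rintro h; simp [h] at h1
  have hp2 : p 2 ≠ 0 := by rintro h; simp [h] at h2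
  set Y : (Fin 3 → ℂ) → ℂ := fun y => y 1 + Complex.I * y 2 with hY
  have hYa : AnalyticAt ℂ Y 0 :=
    (analyticAt_coord 1 0).add (analyticAt_const.mul (analyticAt_coord 2 0))
  set B : (Fin 3 → ℂ) → ℂ := fun y => 1 + p 1 / 8 * Y y with hB
  have hBa : AnalyticAt ℂ B 0 := analyticAt_const.add (analyticAt_const.mul hYa)
  have hB0 : B 0 ≠ 0 := by simp [hB, hY]
  set u : (Fin 3 → ℂ) → ℂ := fun y => Complex.I * p 1 / B y with hu
  have hua : AnalyticAt ℂ u 0 := analyticAt_const.div hBa hB0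
  have hu0 : u 0 ≠ 0 := div_ne_zero (mul_ne_zero Complex.I_ne_zero hp1) hB0
  obtain ⟨r, hr, hru⟩ := exists_analyticAt_sq_eq hua hu0
  have hr0 : r 0 ≠ 0 := by
    intro h0; apply hu0; rw [← hru, h0]; simp
  have hsa : AnalyticAt ℂ (fun y => p 1 * p 2 / 4 / B y) 0 := analyticAt_const.div hBa hB0
  have hs0 : p 1 * p 2 / 4 / B 0 ≠ 0 :=
    div_ne_zero (div_ne_zero (mul_ne_zero hp1 hp2) (by norm_num)) hB0
  -- The remaining form is `YZ(2p₂Y + 2p₁Z + YZ)`, while `y₁²y₂ + y₂³` is a product of `y₂` and `y₁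
  -- ± iy₂`. With `w = -y₁ + iy₂`, the unit `B` is chosen so that the third factor becomes `2p₂(Y +
  -- w)`, a multiple of `y₂`.
  refine hasSimpleSingularityAt_of_splitting hp _
    (U := fun y => y 0 * r y) (Y := Y)
    (Z := fun y => (-coord 1 + Complex.I • coord 2) y * (p 1 * p 2 / 4 / B y))
    (u := u) ((analyticAt_coord 0 0).mul hr) hYa
    (((-coord 1 + Complex.I • coord 2 : (Fin 3 → ℂ) →L[ℂ] ℂ).analyticAt 0).mul hsa) hua hu0
    (by simp) (by simp [hY]) (by simp)
    (hasFDerivAt_clm_mul (coord 0) hr)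
    (coord 1 + Complex.I • coord 2 : (Fin 3 → ℂ) →L[ℂ] ℂ).hasFDerivAt
    (hasFDerivAt_clm_mul (-coord 1 + Complex.I • coord 2) hsa) ?_ ?_
  · intro v e0 e1 e2
    simp only [add_apply, smul_apply, neg_apply,
      ContinuousLinearMap.proj_apply, smul_eq_mul] at e0 e1 e2
    have e0' := (mul_eq_zero.mp e0).resolve_left hr0
    have e2' := (mul_eq_zero.mp e2).resolve_left hs0
    have e3 : v 1 = 0 := by linear_combination (e1 - e2') / 2
    have e4 : v 2 = 0 := by
      rw [e3, zero_add] at e1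
      exact (mul_eq_zero.mp e1).resolve_left Complex.I_ne_zero
    ext i
    fin_cases i <;> assumption
  · filter_upwards [hBa.continuousAt.eventually_ne hB0] with y hy
    simp only [ADE.normalForm, mul_pow, hru, add_apply, smul_apply, neg_apply,
      ContinuousLinearMap.proj_apply, smul_eq_mul]
    have hBy : B y = 1 + p 1 / 8 * (y 1 + Complex.I * y 2) := rfl
    have hYy : Y y = y 1 + Complex.I * y 2 := rfl
    have huy : u y = Complex.I * p 1 / B y := rfl
    have key : Y y * (-y 1 + Complex.I * y 2) = -(y 1 ^ 2 + y 2 ^ 2) := by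
      rw [hYy]; linear_combination y 2 ^ 2 * Complex.I_sq
    have hz : ((p 2 + (-y 1 + Complex.I * y 2) * (p 1 * p 2 / 4 / B y)) ^ 2 - 4) * Y y ^ 2
      + 2 * (p 1 * (p 2 + (-y 1 + Complex.I * y 2) * (p 1 * p 2 / 4 / B y)) - 2 * p 0)
        * ((-y 1 + Complex.I * y 2) * (p 1 * p 2 / 4 / B y)) * Y y
        = Y y * (-y 1 + Complex.I * y 2) * (2 * Complex.I * y 2) * (2 * p 1 / B y) := by
      have hw : 2 * Complex.I * y 2 = Y y + (-y 1 + Complex.I * y 2) := by rw [hYy]; ring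
      rw [hw]
      generalize -y 1 + Complex.I * y 2 = w
      have hz : 4 * B y * (w * (p 1 * p 2 / 4 / B y)) = w * (p 1 * p 2) := by
        field_simp
      have hb : 2 * p 1 / B y * B y = 2 * p 1 := div_mul_cancel₀ _ hy
      rw [← hYy] at hBy
      generalize w * (p 1 * p 2 / 4 / B y) = z at *
      generalize 2 * p 1 / B y = q at *
      generalize B y = b at *
      generalize Y y = s at *
      have e1 : z * (s + 2 * p 1) = 2 * p 2 * w := by
        linear_combination (p 1 / 2) * hz - 2 * p 1 * z * hBy + (-s / 4 * z + p 2 * w / 2) * h1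
      have e2 : 2 * p 2 * z = q * w := by
        refine mul_right_cancel₀ hy ?_
        linear_combination (p 2 / 2) * hz - w * hb + (p 1 * w / 2) * h2
      linear_combination s * z * e1 + s * (s + w) * e2
        + s ^ 2 * h2 + 2 * s * z * h
    rw [hz, key, h1, huy]
    ring

/-- The nondegenerate singular points at which all coordinates are `±2`. -/
theorem hasSimpleSingularityAt_A1_of_sq_eq_four {θ : Fin 4 → ℂ} {p : Fin 3 → ℂ}
    (hp : IsSingularPoint (cubic θ) p) (h1 : p 1 ^ 2 = 4) (h2 : p 2 ^ 2 = 4)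
    (h : p 1 * p 2 ≠ 2 * p 0) :
    HasSimpleSingularityAt (cubic θ) p (.A 1 le_rfl) := by
  set Y : (Fin 3 → ℂ) → ℂ := fun y => y 1 + Complex.I * y 2 with hY
  have hYa : AnalyticAt ℂ Y 0 :=
    (analyticAt_coord 1 0).add (analyticAt_const.mul (analyticAt_coord 2 0))
  set Z : (Fin 3 → ℂ) → ℂ := fun y => y 1 - Complex.I * y 2 with hZ
  have hZa : AnalyticAt ℂ Z 0 :=
    (analyticAt_coord 1 0).sub (analyticAt_const.mul (analyticAt_coord 2 0))
  set u : (Fin 3 → ℂ) → ℂ :=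
    fun y => ((2 * p 2 + Z y) * Y y + 2 * p 1 * (p 2 + Z y) - 4 * p 0) * (-4⁻¹) with hu
  have hua : AnalyticAt ℂ u 0 :=
    ((((analyticAt_const.add hZa).mul hYa).add
      (analyticAt_const.mul (analyticAt_const.add hZa))).sub analyticAt_const).mul analyticAt_const
  have hu0 : u 0 ≠ 0 := by
    have : u 0 = (p 1 * p 2 - 2 * p 0) * (-2⁻¹) := by
      simp only [hu, hY, hZ, Pi.zero_apply]; ring
    rw [this]
    exact mul_ne_zero (sub_ne_zero.mpr h) (by norm_num)
  obtain ⟨r, hr, hru⟩ := exists_analyticAt_sq_eq hua hu0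
  have hr0 : r 0 ≠ 0 := by
    intro h0; apply hu0; rw [← hru, h0]; simp
  -- When `p₁² = p₂² = 4` the remaining form is `YZ` times a unit, because its two square terms
  -- start in higher order; `u` is that unit with its factor `-1/4`.
  refine hasSimpleSingularityAt_of_splitting hp _
    (U := fun y => y 0 * r y) (Y := Y) (Z := Z)
    (u := u) ((analyticAt_coord 0 0).mul hr) hYa hZa hua hu0
    (by simp) (by simp [hY]) (by simp [hZ])
    (hasFDerivAt_clm_mul (coord 0) hr)
    (coord 1 + Complex.I • coord 2 : (Fin 3 → ℂ) →L[ℂ] ℂ).hasFDerivAt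
    (coord 1 - Complex.I • coord 2 : (Fin 3 → ℂ) →L[ℂ] ℂ).hasFDerivAt ?_ ?_
  · intro v e0 e1 e2
    simp only [add_apply, smul_apply, sub_apply,
      ContinuousLinearMap.proj_apply, smul_eq_mul] at e0 e1 e2
    have e0' := (mul_eq_zero.mp e0).resolve_left hr0
    have e3 : v 1 = 0 := by linear_combination (e1 + e2) / 2
    have e4 : v 2 = 0 := by
      rw [e3, zero_add] at e1
      exact (mul_eq_zero.mp e1).resolve_left Complex.I_ne_zero
    ext i
    fin_cases i <;> assumption
  · filter_upwards with y
    simp only [ADE.normalForm, mul_pow, hru]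
    have key : Y y * Z y = y 1 ^ 2 + y 2 ^ 2 := by
      simp only [hY, hZ]; linear_combination -y 2 ^ 2 * Complex.I_sq
    have huy : u y = ((2 * p 2 + Z y) * Y y + 2 * p 1 * (p 2 + Z y) - 4 * p 0) * (-4⁻¹) := rfl
    have : y 0 ^ 2 + y 1 ^ 2 + y 2 ^ (1 + 1) = y 0 ^ 2 + Y y * Z y := by rw [key]; ring
    rw [this, huy]
    linear_combination (-Y y ^ 2 / 4) * h2 - Z y ^ 2 / 4 * h1

/-- Cyclic permutations of the variables preserve the type of a singular point. -/
theorem HasSimpleSingularityAt.rotate {θ : Fin 4 → ℂ} {p : Fin 3 → ℂ} {T : ADE}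
    (h : HasSimpleSingularityAt (cubic ![θ 1, θ 2, θ 0, θ 3]) ![p 1, p 2, p 0] T) :
    HasSimpleSingularityAt (cubic θ) p T := by
  obtain ⟨φ, u, hφ, hφ0, hφ', hu, hu0, heq⟩ := h
  set L : (Fin 3 → ℂ) →L[ℂ] (Fin 3 → ℂ) :=
    ContinuousLinearMap.pi ![coord 2, coord 0, coord 1] with hL
  have hLx (x : Fin 3 → ℂ) : L x = ![x 2, x 0, x 1] := by
    ext i; fin_cases i <;> rfl
  refine ⟨fun y => L (φ y), u, (L.analyticAt _).comp hφ, ?_, ?_, hu, hu0, ?_⟩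
  · simp only [hφ0, hLx]; ext i; fin_cases i <;> rfl
  · have : HasFDerivAt (fun y => L (φ y)) (L.comp (fderiv ℂ φ 0)) 0 :=
      L.hasFDerivAt.comp _ hφ.differentiableAt.hasFDerivAt
    rw [this.fderiv]
    refine Function.Bijective.comp (g := L) ⟨?_, ?_⟩ hφ'
    · intro x y hxy
      rw [hLx, hLx] at hxy
      have h0 := congrFun hxy 0
      have h1 := congrFun hxy 1
      have h2 := congrFun hxy 2
      ext i; fin_cases i
      · exact h1
      · exact h2
      · exact h0
    · intro x
      refine ⟨![x 1, x 2, x 0], ?_⟩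
      rw [hLx]; ext i; fin_cases i <;> rfl
  · filter_upwards [heq] with y hy
    rw [← hy, hLx]
    simp only [cubic, Matrix.cons_val]
    ring

theorem IsSingularPoint.rotate {θ : Fin 4 → ℂ} {p : Fin 3 → ℂ}
    (h : IsSingularPoint (cubic θ) p) :
    IsSingularPoint (cubic ![θ 1, θ 2, θ 0, θ 3]) ![p 1, p 2, p 0] := by
  rw [isSingularPoint_cubic_iff] at h ⊢
  simp only [Matrix.cons_val]
  obtain ⟨h0, h1, h2, h3⟩ := h
  exact ⟨by rw [h1]; ring, by rw [h2]; ring, by rw [h0], by rw [h3]; ring⟩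

theorem hessianForm_rotate (p : Fin 3 → ℂ) :
    hessianForm ![p 1, p 2, p 0] = hessianForm p := by
  simp only [hessianForm, Matrix.cons_val]; ring

/-- A property of the singular points of the cubics that is invariant under cyclic permutations
of the variables holds if some coordinate is not `±2` as soon as it holds when the last one
is not `±2`. -/
theorem hasSimpleSingularityAt_of_exists_sq_ne {T : ADE} (P : (Fin 3 → ℂ) → Prop)
    (hP : ∀ p, P p → P ![p 1, p 2, p 0])
    (H : ∀ θ p, IsSingularPoint (cubic θ) p → P p → p 2 ^ 2 ≠ 4 →
      HasSimpleSingularityAt (cubic θ) p T)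
    {θ : Fin 4 → ℂ} {p : Fin 3 → ℂ} (hp : IsSingularPoint (cubic θ) p) (hPp : P p)
    (h : ∃ i, p i ^ 2 ≠ 4) : HasSimpleSingularityAt (cubic θ) p T := by
  obtain ⟨i, hi⟩ := h
  fin_cases i
  · exact HasSimpleSingularityAt.rotate (H _ _ hp.rotate (hP _ hPp) hi)
  · exact HasSimpleSingularityAt.rotate (HasSimpleSingularityAt.rotate
      (H _ _ hp.rotate.rotate (hP _ (hP _ hPp)) hi))
  · exact H _ _ hp hPp hi

/-! ### The type in terms of the Hessian and the coordinates `±2`. -/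

theorem hasSimpleSingularityAt_A1_of_hessianForm_ne_zero {θ : Fin 4 → ℂ} {p : Fin 3 → ℂ}
    (hp : IsSingularPoint (cubic θ) p) (h : hessianForm p ≠ 0) :
    HasSimpleSingularityAt (cubic θ) p (.A 1 le_rfl) := by
  by_cases h4 : ∃ i, p i ^ 2 ≠ 4
  · refine hasSimpleSingularityAt_of_exists_sq_ne (fun p => hessianForm p ≠ 0)
      (fun p hp => by rwa [hessianForm_rotate]) (fun θ p hp h h2 => ?_) hp h h4
    refine hasSimpleSingularityAt_A hp h2 1 le_rfl
      (fun z => -hessianForm p + z * (2 * p 2 - p 0 * p 1) + z ^ 2)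
      (by fun_prop) (by simpa using h) (fun z => by simp)
  · push Not at h4
    refine hasSimpleSingularityAt_A1_of_sq_eq_four hp (h4 1) (h4 2) fun h' => h ?_
    simp only [hessianForm]
    linear_combination p 0 * h' + h4 0 - h4 1 - h4 2

/-- The identity `4 * hessianForm p + (2p₂ - p₀p₁)² = (p₀² - 4)(p₁² - 4)` shows that the linear term
of the discriminant survives, so the discriminant vanishes to first order. The same identity
separates `A₃`, where the linear term drops out. -/
theorem hasSimpleSingularityAt_A2 {θ : Fin 4 → ℂ} {p : Fin 3 → ℂ}
    (hp : IsSingularPoint (cubic θ) p) (h : hessianForm p = 0) (h4 : ∀ i, p i ^ 2 ≠ 4) :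
    HasSimpleSingularityAt (cubic θ) p (.A 2 one_le_two) := by
  refine hasSimpleSingularityAt_A hp (h4 2) 2 one_le_two
    (fun z => 2 * p 2 - p 0 * p 1 + z) (by fun_prop) ?_ (fun z => by rw [h]; ring)
  rw [add_zero]
  intro h'
  refine mul_ne_zero (sub_ne_zero.mpr (h4 0)) (sub_ne_zero.mpr (h4 1)) ?_
  simp only [hessianForm] at h
  linear_combination 4 * h + (2 * p 2 - p 0 * p 1) * h'

theorem hasSimpleSingularityAt_A3 {θ : Fin 4 → ℂ} {p : Fin 3 → ℂ}
    (hp : IsSingularPoint (cubic θ) p) (h : hessianForm p = 0) (h4 : ∃ i, p i ^ 2 = 4)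
    (h4' : ∃ i, p i ^ 2 ≠ 4) :
    HasSimpleSingularityAt (cubic θ) p (.A 3 (by norm_num)) := by
  refine hasSimpleSingularityAt_of_exists_sq_ne (fun p => hessianForm p = 0 ∧ ∃ i, p i ^ 2 = 4)
      (fun p ⟨h, i, hi⟩ => ⟨by rwa [hessianForm_rotate], i - 1, ?_⟩)
      (fun θ p hp ⟨h, h4⟩ h2 => ?_) hp ⟨h, h4⟩ h4'
  · fin_cases i <;> exact hi
  · have h' : 2 * p 2 - p 0 * p 1 = 0 := by
      rw [← sq_eq_zero_iff]
      simp only [hessianForm] at h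
      obtain ⟨i, hi⟩ := h4
      fin_cases i
      · simp only [Fin.zero_eta] at hi
        linear_combination -4 * h + (p 1 ^ 2 - 4) * hi
      · simp only [Fin.mk_one] at hi
        linear_combination -4 * h + (p 0 ^ 2 - 4) * hi
      · exact absurd hi h2
    refine hasSimpleSingularityAt_A hp h2 3 (by norm_num) (fun _ => 1) analyticAt_const
      one_ne_zero (fun z => by rw [h, h']; ring)

theorem hasSimpleSingularityAt_D4_of_forall {θ : Fin 4 → ℂ} {p : Fin 3 → ℂ}
    (hp : IsSingularPoint (cubic θ) p) (h : hessianForm p = 0) (h4 : ∀ i, p i ^ 2 = 4) :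
    HasSimpleSingularityAt (cubic θ) p (.D 4 le_rfl) := by
  refine hasSimpleSingularityAt_D4 hp (h4 1) (h4 2) ?_
  simp only [hessianForm] at h
  rw [← sub_eq_zero, ← sq_eq_zero_iff]
  linear_combination -4 * h + (p 2 ^ 2 - 4) * h4 1

/-! ### The singular points of the surfaces `𝒮(θ)` in terms of the local monodromy data -/

/-- The singular point that corresponds to representations whose `l`-th local monodromy matrix
is a scalar. -/
noncomputable def scalarPoint (a : Fin 4 → ℂ) (l : Fin 4) : Fin 3 → ℂ :=
  (a l / 2) • ![![a 3, a 2, a 1], ![a 2, a 3, a 0], ![a 1, a 0, a 3], ![a 0, a 1, a 2]] l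

/-- The singular point that corresponds to reducible representations with local eigenvalues
`β₁, β₂, β₃, β₄` on a subrepresentation. -/
noncomputable def reduciblePoint (β : Fin 4 → ℂ) : Fin 3 → ℂ :=
  ![β 1 * β 2 + (β 1 * β 2)⁻¹, β 0 * β 2 + (β 0 * β 2)⁻¹, β 0 * β 1 + (β 0 * β 1)⁻¹]

/-- With `a l = 2ε`, appending 2 to the point gives `ε` times a Klein four-group permutation of `a`,
and such changes preserve `cubicCoeff`. -/
theorem isSingularPoint_scalarPoint {a : Fin 4 → ℂ} {l : Fin 4} (h : a l ^ 2 = 4) :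
    IsSingularPoint (cubic (cubicCoeff a)) (scalarPoint a l) := by
  rw [isSingularPoint_cubic_iff]
  fin_cases l <;> simp [scalarPoint, cubicCoeff] at h ⊢ <;> refine ⟨?_, ?_, ?_, ?_⟩
  · linear_combination (-a 1 * a 2 / 4) * h
  · linear_combination (-a 3 * a 1 / 4) * h
  · linear_combination (-a 3 * a 2 / 4) * h
  · linear_combination (1 - (a 1 ^ 2 + a 2 ^ 2 + a 3 ^ 2) / 4 - a 0 * a 1 * a 2 * a 3 / 4) * h
  · linear_combination (-a 3 * a 0 / 4) * h
  · linear_combination (-a 0 * a 2 / 4) * h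
  · linear_combination (-a 3 * a 2 / 4) * h
  · linear_combination (1 - (a 0 ^ 2 + a 2 ^ 2 + a 3 ^ 2) / 4 - a 0 * a 1 * a 2 * a 3 / 4) * h
  · linear_combination (-a 3 * a 0 / 4) * h
  · linear_combination (-a 3 * a 1 / 4) * h
  · linear_combination (-a 0 * a 1 / 4) * h
  · linear_combination (1 - (a 1 ^ 2 + a 0 ^ 2 + a 3 ^ 2) / 4 - a 0 * a 1 * a 2 * a 3 / 4) * h
  · linear_combination (-a 1 * a 2 / 4) * h
  · linear_combination (-a 0 * a 2 / 4) * h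
  · linear_combination (-a 0 * a 1 / 4) * h
  · linear_combination (1 - (a 1 ^ 2 + a 2 ^ 2 + a 0 ^ 2) / 4 - a 0 * a 1 * a 2 * a 3 / 4) * h

theorem isSingularPoint_reduciblePoint {a β : Fin 4 → ℂ} (ha : ∀ i, a i = β i + (β i)⁻¹)
    (h : β 0 * β 1 * β 2 * β 3 = 1) :
    IsSingularPoint (cubic (cubicCoeff a)) (reduciblePoint β) := by
  have h0 : β 0 ≠ 0 := by rintro h0; simp [h0] at h
  have h1 : β 1 ≠ 0 := by rintro h0; simp [h0] at h
  have h2 : β 2 ≠ 0 := by rintro h0; simp [h0] at h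
  have h3 : β 3 = (β 0 * β 1 * β 2)⁻¹ := eq_inv_of_mul_eq_one_right h
  rw [isSingularPoint_cubic_iff]
  simp only [cubicCoeff, reduciblePoint, Matrix.cons_val, ha, h3]
  refine ⟨?_, ?_, ?_, ?_⟩ <;> field_simp <;> ring

/-! ### Fibres of `cubicCoeff` through quadruples with last entry 2. -/

theorem exists_sq_add_inv_sq (p : ℂ) : ∃ g : ℂ, g ≠ 0 ∧ p = g ^ 2 + (g ^ 2)⁻¹ := by
  obtain ⟨z, hz⟩ := Complex.cos_surjective (p / 2)
  refine ⟨Complex.exp (z * Complex.I / 2), Complex.exp_ne_zero _, ?_⟩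
  rw [← Complex.exp_nat_mul, ← Complex.exp_neg]
  have : p = 2 * Complex.cos z := by rw [hz]; ring
  rw [this, Complex.two_cos]
  push_cast
  congr 2 <;> ring

/-- Quadruples of complex numbers with the same squares and the same product differ by an even
number of signs. -/
theorem exists_even_signs {u v : Fin 4 → ℂ} (h : ∀ i, u i ^ 2 = v i ^ 2)
    (hprod : u 0 * u 1 * u 2 * u 3 = v 0 * v 1 * v 2 * v 3) :
    ∃ e : Fin 4 → ℂ, (∀ i, e i = 1 ∨ e i = -1) ∧ e 0 * e 1 * e 2 * e 3 = 1 ∧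
      ∀ i, u i = e i * v i := by
  have hs (i : Fin 4) : ∃ e : ℂ, (e = 1 ∨ e = -1) ∧ u i = e * v i := by
    rcases sq_eq_sq_iff_eq_or_eq_neg.mp (h i) with h | h
    · exact ⟨1, Or.inl rfl, by simpa using h⟩
    · exact ⟨-1, Or.inr rfl, by simpa using h⟩
  choose e he hue using hs
  have hsq : e 0 * e 1 * e 2 * e 3 = 1 ∨ e 0 * e 1 * e 2 * e 3 = -1 := by
    rcases he 0 with h0 | h0 <;> rcases he 1 with h1 | h1 <;> rcases he 2 with h2 | h2 <;>
      rcases he 3 with h3 | h3 <;> simp [h0, h1, h2, h3]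
  rcases hsq with h1 | h1
  · exact ⟨e, he, h1, hue⟩
  · have hv : v 0 * v 1 * v 2 * v 3 = 0 := by
      rw [hue 0, hue 1, hue 2, hue 3] at hprod
      linear_combination -(1 / 2) * hprod + (v 0 * v 1 * v 2 * v 3) / 2 * h1
    have hi : ∃ i, v i = 0 := by
      simp only [mul_eq_zero] at hv
      rcases hv with ((h | h) | h) | h
      exacts [⟨_, h⟩, ⟨_, h⟩, ⟨_, h⟩, ⟨_, h⟩]
    obtain ⟨i, hi⟩ := hi
    refine ⟨Function.update e i (-e i), fun j => ?_, ?_, fun j => ?_⟩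
    · rcases eq_or_ne j i with rfl | hj
      · rw [Function.update_self]
        rcases he j with h | h <;> simp [h]
      · rw [Function.update_of_ne hj]; exact he j
    · fin_cases i <;> simp [Function.update] <;> linear_combination -h1
    · rcases eq_or_ne j i with rfl | hj
      · rw [hue, hi, mul_zero, mul_zero]
      · rw [Function.update_of_ne hj]; exact hue j

/-- Coordinates on the local monodromy data in which the fibres of `cubicCoeff` are easy to
describe. -/
def fourierCoord (a : Fin 4 → ℂ) : Fin 4 → ℂ :=
  ![a 0 + a 1 + a 2 + a 3, a 0 + a 3 - a 1 - a 2, a 1 + a 3 - a 0 - a 2, a 2 + a 3 - a 0 - a 1]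

theorem fourierCoord_sq (a : Fin 4 → ℂ) :
    fourierCoord a 1 ^ 2 = fourierCoord a 0 ^ 2 - 4 * (cubicCoeff a 1 + cubicCoeff a 2) ∧
    fourierCoord a 2 ^ 2 = fourierCoord a 0 ^ 2 - 4 * (cubicCoeff a 0 + cubicCoeff a 2) ∧
    fourierCoord a 3 ^ 2 = fourierCoord a 0 ^ 2 - 4 * (cubicCoeff a 0 + cubicCoeff a 1) := by
  simp only [fourierCoord, cubicCoeff, Matrix.cons_val]
  refine ⟨?_, ?_, ?_⟩ <;> ring

/-- The product of the Fourier coordinates, in terms of the sum of the data and of the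
coefficients of the cubic. -/
def fourierProd (s : ℂ) (θ : Fin 4 → ℂ) : ℂ :=
  32 * (θ 3 + 4) + s ^ 2 - 32 * s - 4 * s * (θ 0 + θ 1 + θ 2)
    + 64 * (θ 0 + θ 1 + θ 2) + 8 * (θ 0 * θ 1 + θ 0 * θ 2 + θ 1 * θ 2)

theorem fourierCoord_prod (a : Fin 4 → ℂ) :
    fourierCoord a 0 * fourierCoord a 1 * fourierCoord a 2 * fourierCoord a 3 =
      fourierProd (fourierCoord a 0 ^ 2) (cubicCoeff a) := by
  simp only [fourierCoord, cubicCoeff, fourierProd, Matrix.cons_val]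
  ring

/-- Squaring the product formula yields an equation in `s = u₀²` whose quartic terms cancel. The
remaining cubic must vanish at the value coming from `(p, 2)` itself, and its other root is double.
-/
theorem fourierCoord_dichotomy {a : Fin 4 → ℂ} {p : Fin 3 → ℂ}
    (h : cubicCoeff a = cubicCoeff ![p 0, p 1, p 2, 2]) :
    fourierCoord a 0 ^ 2 = fourierCoord ![p 0, p 1, p 2, 2] 0 ^ 2 ∨
      fourierCoord a 0 ^ 2 = (p 0 + 2) * (p 1 + 2) * (p 2 + 2) := by
  obtain ⟨h1, h2, h3⟩ := fourierCoord_sq a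
  have h4 := congrArg (· ^ 2) (fourierCoord_prod a)
  simp only [mul_pow] at h4
  rw [h1, h2, h3, h] at h4
  generalize fourierCoord a 0 ^ 2 = s at h4 ⊢
  simp only [fourierCoord, cubicCoeff, fourierProd, Matrix.cons_val] at h4 ⊢
  have : (s - (p 0 + p 1 + p 2 + 2) ^ 2) * (s - (p 0 + 2) * (p 1 + 2) * (p 2 + 2)) ^ 2 = 0 := by
    linear_combination (1 / 64) * h4
  rcases mul_eq_zero.mp this with h | h
  · exact Or.inl (sub_eq_zero.mp h)
  · exact Or.inr (sub_eq_zero.mp (sq_eq_zero_iff.mp h))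

theorem eq_of_fourierCoord (a : Fin 4 → ℂ) :
    a 0 = (fourierCoord a 0 + fourierCoord a 1 - fourierCoord a 2 - fourierCoord a 3) / 4 ∧
    a 1 = (fourierCoord a 0 - fourierCoord a 1 + fourierCoord a 2 - fourierCoord a 3) / 4 ∧
    a 2 = (fourierCoord a 0 - fourierCoord a 1 - fourierCoord a 2 + fourierCoord a 3) / 4 ∧
    a 3 = (fourierCoord a 0 + fourierCoord a 1 + fourierCoord a 2 + fourierCoord a 3) / 4 := by
  simp only [fourierCoord, Matrix.cons_val]
  refine ⟨?_, ?_, ?_, ?_⟩ <;> ring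

/-- An even choice of signs comes, up to a common sign, from the Klein four-group. -/
theorem even_signs_cases {e : Fin 4 → ℂ} (he : ∀ i, e i = 1 ∨ e i = -1)
    (hprod : e 0 * e 1 * e 2 * e 3 = 1) :
    ∃ ε : ℂ, (ε = 1 ∨ ε = -1) ∧ e 0 = ε ∧
      ((e 1 = ε ∧ e 2 = ε ∧ e 3 = ε) ∨ (e 1 = ε ∧ e 2 = -ε ∧ e 3 = -ε) ∨
        (e 1 = -ε ∧ e 2 = ε ∧ e 3 = -ε) ∨ (e 1 = -ε ∧ e 2 = -ε ∧ e 3 = ε)) := by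
  refine ⟨e 0, he 0, rfl, ?_⟩
  rcases he 0 with h0 | h0 <;> rcases he 1 with h1 | h1 <;> rcases he 2 with h2 | h2 <;>
    rcases he 3 with h3 | h3 <;> simp [h0, h1, h2, h3] at hprod ⊢ <;> norm_num at hprod

/-- Here all squares and the product of the Fourier coordinates agree with those of `(p, 2)`. Even
sign changes act on the original quadruple as Klein four-group permutations and a common sign, so
the entry 2 reappears, up to sign, as some `a l`. -/
theorem eq_scalarPoint_of_fourierCoord {a : Fin 4 → ℂ} {p : Fin 3 → ℂ}
    (h : cubicCoeff a = cubicCoeff ![p 0, p 1, p 2, 2])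
    (hs : fourierCoord a 0 ^ 2 = fourierCoord ![p 0, p 1, p 2, 2] 0 ^ 2) :
    ∃ l, a l ^ 2 = 4 ∧ p = scalarPoint a l := by
  set v := fourierCoord ![p 0, p 1, p 2, 2] with hv
  obtain ⟨h1, h2, h3⟩ := fourierCoord_sq a
  obtain ⟨k1, k2, k3⟩ := fourierCoord_sq ![p 0, p 1, p 2, 2]
  have hsq : ∀ i, fourierCoord a i ^ 2 = v i ^ 2 := by
    intro i
    fin_cases i
    · exact hs
    · exact (h1.trans (by rw [hs, h])).trans k1.symm
    · exact (h2.trans (by rw [hs, h])).trans k2.symm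
    · exact (h3.trans (by rw [hs, h])).trans k3.symm
  have hpr : fourierCoord a 0 * fourierCoord a 1 * fourierCoord a 2 * fourierCoord a 3 =
      v 0 * v 1 * v 2 * v 3 := by
    rw [fourierCoord_prod, hv, fourierCoord_prod, hs, h]
  obtain ⟨e, he, hep, heu⟩ := exists_even_signs hsq hpr
  obtain ⟨a0, a1, a2, a3⟩ := eq_of_fourierCoord a
  obtain ⟨ε, hε, e0, hc⟩ := even_signs_cases he hep
  have hε2 : ε ^ 2 = 1 := by rcases hε with rfl | rfl <;> norm_num
  rw [heu 0, heu 1, heu 2, heu 3, e0] at a0 a1 a2 a3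
  simp only [hv, fourierCoord, Matrix.cons_val] at a0 a1 a2 a3
  rcases hc with ⟨e1, e2, e3⟩ | ⟨e1, e2, e3⟩ | ⟨e1, e2, e3⟩ | ⟨e1, e2, e3⟩ <;>
    rw [e1, e2, e3] at a0 a1 a2 a3 <;> ring_nf at a0 a1 a2 a3
  · refine ⟨3, by rw [a3]; linear_combination 4 * hε2, ?_⟩
    ext i; fin_cases i <;> simp [scalarPoint, a0, a1, a2, a3] <;>
      linear_combination -p _ * hε2
  · refine ⟨0, by rw [a0]; linear_combination 4 * hε2, ?_⟩
    ext i; fin_cases i <;> simp [scalarPoint, a0, a1, a2, a3] <;>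
      linear_combination -p _ * hε2
  · refine ⟨1, by rw [a1]; linear_combination 4 * hε2, ?_⟩
    ext i; fin_cases i <;> simp [scalarPoint, a0, a1, a2, a3] <;>
      linear_combination -p _ * hε2
  · refine ⟨2, by rw [a2]; linear_combination 4 * hε2, ?_⟩
    ext i; fin_cases i <;> simp [scalarPoint, a0, a1, a2, a3] <;>
      linear_combination -p _ * hε2

theorem eq_or_eq_inv_of_add_inv_eq {b β : ℂ} (hb : b ≠ 0) (hβ : β ≠ 0)
    (h : b + b⁻¹ = β + β⁻¹) : β = b ∨ β = b⁻¹ := by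
  have : (β - b) * (β * b - 1) = 0 := by
    field_simp at h
    linear_combination -h
  rcases mul_eq_zero.mp this with h | h
  · exact Or.inl (sub_eq_zero.mp h)
  · exact Or.inr (eq_inv_of_mul_eq_one_left (sub_eq_zero.mp h))

/-- The Fourier coordinates of a reducible datum, in terms of square roots of the quotients of its
eigenvalues. -/
noncomputable def reducibleFourier (g : Fin 3 → ℂ) : Fin 4 → ℂ :=
  ![(g 0 + (g 0)⁻¹) * (g 1 + (g 1)⁻¹) * (g 2 + (g 2)⁻¹),
    (g 0 + (g 0)⁻¹) * (g 1 - (g 1)⁻¹) * (g 2 - (g 2)⁻¹),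
    (g 0 - (g 0)⁻¹) * (g 1 + (g 1)⁻¹) * (g 2 - (g 2)⁻¹),
    (g 0 - (g 0)⁻¹) * (g 1 - (g 1)⁻¹) * (g 2 + (g 2)⁻¹)]

/-- Writing `p i = g i ^ 2 + (g i ^ 2)⁻¹` turns `p i ± 2` into squares of `g i ± (g i)⁻¹`, so the
Fourier coordinates are known up to an even number of signs. -/
theorem exists_reducibleFourier_eq {a : Fin 4 → ℂ} {p : Fin 3 → ℂ}
    (h : cubicCoeff a = cubicCoeff ![p 0, p 1, p 2, 2])
    (hs : fourierCoord a 0 ^ 2 = (p 0 + 2) * (p 1 + 2) * (p 2 + 2)) :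
    ∃ g : Fin 3 → ℂ, (∀ i, g i ≠ 0) ∧ (∀ i, p i = g i ^ 2 + (g i ^ 2)⁻¹) ∧
      ∀ i, fourierCoord a i = reducibleFourier g i := by
  choose g hg hp using fun i => exists_sq_add_inv_sq (p i)
  obtain ⟨h1, h2, h3⟩ := fourierCoord_sq a
  have hr (i : Fin 3) : (g i + (g i)⁻¹) ^ 2 = p i + 2 := by
    have := hg i
    rw [hp i]; field_simp; ring
  have ht (i : Fin 3) : (g i - (g i)⁻¹) ^ 2 = p i - 2 := by
    have := hg i
    rw [hp i]; field_simp; ring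
  have hsq : ∀ i, fourierCoord a i ^ 2 = reducibleFourier g i ^ 2 := by
    intro i
    fin_cases i
    · change fourierCoord a 0 ^ 2 = reducibleFourier g 0 ^ 2
      rw [hs]
      simp only [reducibleFourier, mul_pow, Matrix.cons_val, hr]
    · change fourierCoord a 1 ^ 2 = reducibleFourier g 1 ^ 2
      rw [h1, hs, h]
      simp only [reducibleFourier, mul_pow, Matrix.cons_val, hr, ht, cubicCoeff]
      ring
    · change fourierCoord a 2 ^ 2 = reducibleFourier g 2 ^ 2
      rw [h2, hs, h]
      simp only [reducibleFourier, mul_pow, Matrix.cons_val, hr, ht, cubicCoeff]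
      ring
    · change fourierCoord a 3 ^ 2 = reducibleFourier g 3 ^ 2
      rw [h3, hs, h]
      simp only [reducibleFourier, mul_pow, Matrix.cons_val, hr, ht, cubicCoeff]
      ring
  have hpr : fourierCoord a 0 * fourierCoord a 1 * fourierCoord a 2 * fourierCoord a 3 =
      reducibleFourier g 0 * reducibleFourier g 1 * reducibleFourier g 2 *
        reducibleFourier g 3 := by
    rw [fourierCoord_prod, hs, h]
    have : reducibleFourier g 0 * reducibleFourier g 1 * reducibleFourier g 2 *
        reducibleFourier g 3 = (p 0 + 2) * (p 1 + 2) * (p 2 + 2) *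
          ((p 0 - 2) * (p 1 - 2) * (p 2 - 2)) := by
      rw [← hr 0, ← hr 1, ← hr 2, ← ht 0, ← ht 1, ← ht 2]
      simp only [reducibleFourier, Matrix.cons_val]
      ring
    rw [this]
    simp only [fourierProd, cubicCoeff, Matrix.cons_val]
    ring
  obtain ⟨e, he, hep, heu⟩ := exists_even_signs hsq hpr
  obtain ⟨ε, hε, e0, hc⟩ := even_signs_cases he hep
  have hε0 : ε ≠ 0 := by rcases hε with rfl | rfl <;> norm_num
  have hε2 : ε ^ 2 = 1 := by rcases hε with rfl | rfl <;> norm_num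
  have hεi : ε⁻¹ = ε := by rcases hε with rfl | rfl <;> norm_num
  -- The signs are absorbed in `g`: inverting one `g i` negates the two coordinates that contain `g
  -- i - (g i)⁻¹`, and scaling one `g i` by `ε` multiplies all four by `ε`. Neither changes `p`.
  rcases hc with ⟨e1, e2, e3⟩ | ⟨e1, e2, e3⟩ | ⟨e1, e2, e3⟩ | ⟨e1, e2, e3⟩
  · refine ⟨![ε * g 0, g 1, g 2], fun i => ?_, fun i => ?_, fun i => ?_⟩
    · fin_cases i <;> simp [hg, hε0]
    · fin_cases i <;> simp [hp, mul_pow, hε2]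
    · rw [heu]
      fin_cases i <;> simp [reducibleFourier, e0, e1, e2, e3, hεi] <;> ring
  · refine ⟨![ε * (g 0)⁻¹, g 1, g 2], fun i => ?_, fun i => ?_, fun i => ?_⟩
    · fin_cases i <;> simp [hg, hε0]
    · fin_cases i <;> simp [hp, mul_pow, hε2, add_comm]
    · rw [heu]
      fin_cases i <;> simp [reducibleFourier, e0, e1, e2, e3, hεi] <;> ring
  · refine ⟨![g 0, ε * (g 1)⁻¹, g 2], fun i => ?_, fun i => ?_, fun i => ?_⟩
    · fin_cases i <;> simp [hg, hε0]
    · fin_cases i <;> simp [hp, mul_pow, hε2, add_comm]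
    · rw [heu]
      fin_cases i <;> simp [reducibleFourier, e0, e1, e2, e3, hεi] <;> ring
  · refine ⟨![g 0, g 1, ε * (g 2)⁻¹], fun i => ?_, fun i => ?_, fun i => ?_⟩
    · fin_cases i <;> simp [hg, hε0]
    · fin_cases i <;> simp [hp, mul_pow, hε2, add_comm]
    · rw [heu]
      fin_cases i <;> simp [reducibleFourier, e0, e1, e2, e3, hεi] <;> ring

theorem eq_reduciblePoint_of_fourierCoord {a b : Fin 4 → ℂ} {p : Fin 3 → ℂ}
    (hb : ∀ i, b i ≠ 0) (ha : ∀ i, a i = b i + (b i)⁻¹)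
    (h : cubicCoeff a = cubicCoeff ![p 0, p 1, p 2, 2])
    (hs : fourierCoord a 0 ^ 2 = (p 0 + 2) * (p 1 + 2) * (p 2 + 2)) :
    ∃ β : Fin 4 → ℂ, (∀ i, β i = b i ∨ β i = (b i)⁻¹) ∧ β 0 * β 1 * β 2 * β 3 = 1 ∧
      p = reduciblePoint β := by
  obtain ⟨g, hg, hp, hu⟩ := exists_reducibleFourier_eq h hs
  obtain ⟨a0, a1, a2, a3⟩ := eq_of_fourierCoord a
  rw [hu 0, hu 1, hu 2, hu 3] at a0 a1 a2 a3
  simp only [reducibleFourier, Matrix.cons_val] at a0 a1 a2 a3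
  have hg0 := hg 0
  have hg1 := hg 1
  have hg2 := hg 2
  -- Expanding the inverse Fourier transform of `reducibleFourier g` leaves in each entry one
  -- monomial and its inverse; these monomials are the eigenvalues.
  refine ⟨![g 0 / (g 1 * g 2), g 1 / (g 0 * g 2), g 2 / (g 0 * g 1), g 0 * g 1 * g 2],
    fun i => eq_or_eq_inv_of_add_inv_eq (hb i) ?_ ?_, ?_, ?_⟩
  · fin_cases i <;> simp [hg]
  · rw [← ha]
    fin_cases i <;> simp
    · rw [a0]; field_simp; ring
    · rw [a1]; field_simp; ring
    · rw [a2]; field_simp; ring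
    · rw [a3]; field_simp; ring
  · simp; field_simp
  · ext i
    rw [hp]
    fin_cases i <;> simp [reduciblePoint] <;> field_simp <;> ring

/-- The singular points of the cubic surfaces. -/
theorem eq_scalarPoint_or_eq_reduciblePoint {a b : Fin 4 → ℂ} {p : Fin 3 → ℂ}
    (hb : ∀ i, b i ≠ 0) (ha : ∀ i, a i = b i + (b i)⁻¹)
    (hp : IsSingularPoint (cubic (cubicCoeff a)) p) :
    (∃ l, a l ^ 2 = 4 ∧ p = scalarPoint a l) ∨
      ∃ β : Fin 4 → ℂ, (∀ i, β i = b i ∨ β i = (b i)⁻¹) ∧ β 0 * β 1 * β 2 * β 3 = 1 ∧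
        p = reduciblePoint β := by
  have h : cubicCoeff a = cubicCoeff ![p 0, p 1, p 2, 2] := by
    obtain ⟨h0, h1, h2, h3⟩ := (isSingularPoint_cubic_iff _ _).mp hp
    ext i
    fin_cases i
    · exact h0.trans (by simp [cubicCoeff]; ring)
    · exact h1.trans (by simp [cubicCoeff]; ring)
    · exact h2.trans (by simp [cubicCoeff]; ring)
    · exact h3.trans (by simp [cubicCoeff]; ring)
  rcases fourierCoord_dichotomy h with hs | hs
  · exact Or.inl (eq_scalarPoint_of_fourierCoord h hs)
  · exact Or.inr (eq_reduciblePoint_of_fourierCoord hb ha h hs)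

/-! ### Factorizations of the Hessian at singular points. -/

theorem hessianForm_reduciblePoint {β : Fin 4 → ℂ} (h : β 0 * β 1 * β 2 * β 3 = 1) :
    hessianForm (reduciblePoint β) = -(β 0 - (β 0)⁻¹) * (β 1 - (β 1)⁻¹) * (β 2 - (β 2)⁻¹)
      * (β 3 - (β 3)⁻¹) := by
  have h0 : β 0 ≠ 0 := by rintro h0; simp [h0] at h
  have h1 : β 1 ≠ 0 := by rintro h0; simp [h0] at h
  have h2 : β 2 ≠ 0 := by rintro h0; simp [h0] at h
  have h3 : β 3 = (β 0 * β 1 * β 2)⁻¹ := eq_inv_of_mul_eq_one_right h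
  simp only [hessianForm, reduciblePoint, Matrix.cons_val, h3]
  field_simp
  ring

theorem hessianForm_smul_ne_zero {w x y z : ℂ} (hw : w ^ 2 = 1) (hx : x ≠ 0) (hy : y ≠ 0)
    (hz : z ≠ 0) (h0 : x * y * z * w ≠ 1) (h1 : x⁻¹ * y * z * w ≠ 1) (h2 : x * y⁻¹ * z * w ≠ 1)
    (h3 : x * y * z⁻¹ * w ≠ 1) :
    hessianForm (w • ![x + x⁻¹, y + y⁻¹, z + z⁻¹]) ≠ 0 := by
  have key : hessianForm (w • ![x + x⁻¹, y + y⁻¹, z + z⁻¹]) =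
      w * (x * y * z * w - 1) * (x⁻¹ * y * z * w - 1) * (x * y⁻¹ * z * w - 1)
        * (x * y * z⁻¹ * w - 1) / (x * y * z) := by
    have hw3 : w ^ 3 = w := by linear_combination w * hw
    have hw4 : w ^ 4 = 1 := by linear_combination (w ^ 2 + 1) * hw
    have hw5 : w ^ 5 = w := by linear_combination (w ^ 3 + w) * hw
    simp only [hessianForm, Pi.smul_apply, smul_eq_mul, Matrix.cons_val]
    field_simp
    ring_nf
    simp only [hw, hw3, hw4, hw5]
    ring
  have hw0 : w ≠ 0 := by rintro rfl; simp at hw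
  rw [key]
  exact div_ne_zero (mul_ne_zero (mul_ne_zero (mul_ne_zero (mul_ne_zero hw0 (sub_ne_zero.mpr h0))
    (sub_ne_zero.mpr h1)) (sub_ne_zero.mpr h2)) (sub_ne_zero.mpr h3))
    (mul_ne_zero (mul_ne_zero hx hy) hz)

/-- Since `b l = ±1`, the Hessian factors over the products of `b l` with the other three
eigenvalues or their inverses. Up to inverting everything there are four such products, and a
vanishing factor would be a reducibility relation. -/
theorem hessianForm_scalarPoint_ne_zero {a b : Fin 4 → ℂ}
    (hb : ∀ i, b i ≠ 0) (ha : ∀ i, a i = b i + (b i)⁻¹)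
    (h : ∀ β : Fin 4 → ℂ, (∀ i, β i = b i ∨ β i = (b i)⁻¹) → β 0 * β 1 * β 2 * β 3 ≠ 1)
    {l : Fin 4} (hl : a l ^ 2 = 4) : hessianForm (scalarPoint a l) ≠ 0 := by
  have hbl : b l ^ 2 = 1 := by
    rw [ha] at hl
    have := hb l
    have : (b l ^ 2 - 1) ^ 2 = 0 := by
      field_simp at hl
      linear_combination hl
    exact sub_eq_zero.mp (sq_eq_zero_iff.mp this)
  have hal : a l = 2 * b l := by
    rw [ha, inv_eq_of_mul_eq_one_right (by rw [← sq]; exact hbl)]; ring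
  have hal2 : a l / 2 = b l := by rw [hal]; ring
  rw [scalarPoint, hal2, ha 0, ha 1, ha 2, ha 3]
  have H (β : Fin 4 → ℂ) (hβ : ∀ i, β i = b i ∨ β i = (b i)⁻¹) {c : ℂ}
      (hc : c = β 0 * β 1 * β 2 * β 3) : c ≠ 1 := hc ▸ h β hβ
  fin_cases l
  · refine hessianForm_smul_ne_zero hbl (hb 3) (hb 2) (hb 1)
      (H ![b 0, b 1, b 2, b 3] ?_ ?_) (H ![b 0, b 1, b 2, (b 3)⁻¹] ?_ ?_)
      (H ![b 0, b 1, (b 2)⁻¹, b 3] ?_ ?_) (H ![b 0, (b 1)⁻¹, b 2, b 3] ?_ ?_)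
    all_goals first | (intro i; fin_cases i <;> simp) | (simp; ring)
  · refine hessianForm_smul_ne_zero hbl (hb 2) (hb 3) (hb 0)
      (H ![b 0, b 1, b 2, b 3] ?_ ?_) (H ![b 0, b 1, (b 2)⁻¹, b 3] ?_ ?_)
      (H ![b 0, b 1, b 2, (b 3)⁻¹] ?_ ?_) (H ![(b 0)⁻¹, b 1, b 2, b 3] ?_ ?_)
    all_goals first | (intro i; fin_cases i <;> simp) | (simp; ring)
  · refine hessianForm_smul_ne_zero hbl (hb 1) (hb 0) (hb 3)
      (H ![b 0, b 1, b 2, b 3] ?_ ?_) (H ![b 0, (b 1)⁻¹, b 2, b 3] ?_ ?_)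
      (H ![(b 0)⁻¹, b 1, b 2, b 3] ?_ ?_) (H ![b 0, b 1, b 2, (b 3)⁻¹] ?_ ?_)
    all_goals first | (intro i; fin_cases i <;> simp) | (simp; ring)
  · refine hessianForm_smul_ne_zero hbl (hb 0) (hb 1) (hb 2)
      (H ![b 0, b 1, b 2, b 3] ?_ ?_) (H ![(b 0)⁻¹, b 1, b 2, b 3] ?_ ?_)
      (H ![b 0, (b 1)⁻¹, b 2, b 3] ?_ ?_) (H ![b 0, b 1, (b 2)⁻¹, b 3] ?_ ?_)
    all_goals first | (intro i; fin_cases i <;> simp) | simp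

/-! ### Invariance of the Riemann–Hilbert correspondence under the affine Weyl group -/

theorem basicReflection_apply (i : Fin 5) (κ : Exponents) (j : Fin 5) :
    (basicReflection i κ : Exponents) j = κ j - κ i * (cartanAffineD4 i j : ℂ) := rfl

/-- The local monodromy eigenvalues of an exponent. -/
noncomputable def eigenvalue (κ : Exponents) : Fin 4 → ℂ :=
  ![Complex.exp (Real.pi * Complex.I * κ 1), Complex.exp (Real.pi * Complex.I * κ 2),
    Complex.exp (Real.pi * Complex.I * κ 3), -Complex.exp (Real.pi * Complex.I * κ 4)]

theorem eigenvalue_ne_zero (κ : Exponents) (i : Fin 4) : eigenvalue κ i ≠ 0 := by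
  fin_cases i <;> simp [eigenvalue]

theorem localMonodromy_eq (κ : Exponents) (i : Fin 4) :
    localMonodromy κ i = eigenvalue κ i + (eigenvalue κ i)⁻¹ := by
  have h (z : ℂ) : 2 * Complex.cos (Real.pi * z) =
      Complex.exp (Real.pi * Complex.I * z) + (Complex.exp (Real.pi * Complex.I * z))⁻¹ := by
    rw [← Complex.exp_neg, Complex.two_cos]
    congr 2 <;> ring
  fin_cases i <;> simp only [localMonodromy, eigenvalue] <;> simp [h, ← inv_neg]
  ring

/-- This is the exponential of the affine relation on `κ`; the minus sign in the fourth eigenvalue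
cancels `exp(πi) = -1`. -/
theorem central_sq_mul_eigenvalue (κ : Exponents) :
    Complex.exp (Real.pi * Complex.I * κ 0) ^ 2 *
      (eigenvalue κ 0 * eigenvalue κ 1 * eigenvalue κ 2 * eigenvalue κ 3) = 1 := by
  simp only [eigenvalue, Matrix.cons_val, mul_neg]
  rw [← Complex.exp_nat_mul, ← Complex.exp_add, ← Complex.exp_add, ← Complex.exp_add,
    ← Complex.exp_add]
  have : ((2 : ℕ) : ℂ) * (Real.pi * Complex.I * κ 0) + (Real.pi * Complex.I * κ 1
      + Real.pi * Complex.I * κ 2 + Real.pi * Complex.I * κ 3 + Real.pi * Complex.I * κ 4)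
      = Real.pi * Complex.I := by
    push_cast
    linear_combination Real.pi * Complex.I * κ.2
  rw [this, Complex.exp_pi_mul_I]
  ring

theorem cubicCoeff_central_reflection {b : Fin 4 → ℂ} {c : ℂ}
    (h : c ^ 2 * (b 0 * b 1 * b 2 * b 3) = 1) :
    cubicCoeff (fun i => c * b i + (c * b i)⁻¹) = cubicCoeff (fun i => b i + (b i)⁻¹) := by
  have hc : c ≠ 0 := by rintro rfl; simp at h
  have h0 : b 0 ≠ 0 := by rintro h0; simp [h0] at h
  have h1 : b 1 ≠ 0 := by rintro h0; simp [h0] at h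
  have h2 : b 2 ≠ 0 := by rintro h0; simp [h0] at h
  have h3 : b 3 = (c ^ 2 * (b 0 * b 1 * b 2))⁻¹ :=
    eq_inv_of_mul_eq_one_right (by linear_combination h)
  ext i
  fin_cases i <;> simp [cubicCoeff, h3] <;> field_simp <;> ring

theorem localMonodromy_basicReflection_of_ne_zero {i : Fin 5} (hi : i ≠ 0) (κ : Exponents) :
    localMonodromy (basicReflection i κ) = localMonodromy κ := by
  have h (z : ℂ) : Complex.cos (Real.pi * (z - z * 2)) = Complex.cos (Real.pi * z) := by
    rw [← Complex.cos_neg]; congr 1; ring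
  fin_cases i
  · exact absurd rfl hi
  all_goals simp [localMonodromy, basicReflection_apply, cartanAffineD4, h]

/-- A leaf reflection only changes the sign of one `κ i`, which the cosine ignores. The central one
adds `κ 0` to every leaf and so scales all eigenvalues by `exp(πi κ 0)`, which changes `a` but not
`cubicCoeff a`. -/
theorem rh_basicReflection (i : Fin 5) (κ : Exponents) : rh (basicReflection i κ) = rh κ := by
  by_cases hi : i = 0
  · subst hi
    have hc := cubicCoeff_central_reflection (central_sq_mul_eigenvalue κ)
    have h1 : localMonodromy κ = fun i => eigenvalue κ i + (eigenvalue κ i)⁻¹ :=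
      funext (localMonodromy_eq κ)
    have h2 : localMonodromy (basicReflection 0 κ) = fun i =>
        Complex.exp (Real.pi * Complex.I * κ 0) * eigenvalue κ i
          + (Complex.exp (Real.pi * Complex.I * κ 0) * eigenvalue κ i)⁻¹ := by
      funext i
      rw [localMonodromy_eq]
      have : eigenvalue (basicReflection 0 κ) i =
          Complex.exp (Real.pi * Complex.I * κ 0) * eigenvalue κ i := by
        fin_cases i <;>
          simp [eigenvalue, basicReflection_apply, cartanAffineD4, ← Complex.exp_add] <;>
          ring_nf
      rw [this]
    rw [rh, rh, h1, h2, hc]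
  · rw [rh, rh, localMonodromy_basicReflection_of_ne_zero hi]

theorem rh_apply_of_mem {w : Equiv.Perm Exponents} (hw : w ∈ affineWeylGroup) (κ : Exponents) :
    rh (w κ) = rh κ := by
  induction hw using Subgroup.closure_induction generalizing κ with
  | mem x hx =>
    obtain ⟨i, rfl⟩ := hx
    exact rh_basicReflection i κ
  | one => rfl
  | mul x y _ _ hx hy => rw [Equiv.Perm.mul_apply, hx, hy]
  | inv x _ hx =>
    have := hx (x⁻¹ κ)
    rw [show x (x⁻¹ κ) = κ from x.apply_symm_apply κ] at this
    exact this.symm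

/-! ### Reflecting hyperplanes -/

/-- The hyperplane of the integral linear form with the coefficients `m`. -/
def rootHyperplane (m : Fin 5 → ℤ) : Set Exponents := {κ | ∑ j, (m j : ℂ) * κ j = 0}

/-- The basic reflections on integral linear forms. -/
def reflectRoot (i : Fin 5) (m : Fin 5 → ℤ) : Fin 5 → ℤ :=
  fun j => m j - if j = i then ∑ k, cartanAffineD4 i k * m k else 0

theorem basicReflection_image_rootHyperplane (i : Fin 5) (m : Fin 5 → ℤ) :
    basicReflection i '' rootHyperplane m = rootHyperplane (reflectRoot i m) := by
  have h (κ : Exponents) : ∑ j, (m j : ℂ) * (basicReflection i κ : Exponents) j =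
      ∑ j, (reflectRoot i m j : ℂ) * κ j := by
    fin_cases i <;>
      simp [basicReflection_apply, cartanAffineD4, reflectRoot, Fin.sum_univ_five] <;>
      ring
  ext κ
  rw [Equiv.image_eq_preimage_symm]
  change (∑ j, (m j : ℂ) * (basicReflection i κ : Exponents) j = 0) ↔ _
  rw [h]
  rfl

theorem setOf_eq_zero_eq_rootHyperplane (i : Fin 5) :
    {κ : Exponents | κ i = 0} = rootHyperplane (Pi.single i 1) := by
  ext κ
  simp [rootHyperplane, Pi.single_apply]

/-- The clause for the inverse is carried along so that the induction on the closure passes through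
inverses. -/
theorem exists_image_rootHyperplane {w : Equiv.Perm Exponents} (hw : w ∈ affineWeylGroup) :
    (∀ m, ∃ m', w '' rootHyperplane m = rootHyperplane m') ∧
      (∀ m, ∃ m', (w⁻¹ : Equiv.Perm Exponents) '' rootHyperplane m = rootHyperplane m') := by
  induction hw using Subgroup.closure_induction with
  | mem x hx =>
    obtain ⟨i, rfl⟩ := hx
    exact ⟨fun m => ⟨_, basicReflection_image_rootHyperplane i m⟩,
      fun m => ⟨_, basicReflection_image_rootHyperplane i m⟩⟩
  | one => exact ⟨fun m => ⟨m, by simp⟩, fun m => ⟨m, by simp⟩⟩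
  | mul x y _ _ hx hy =>
    refine ⟨fun m => ?_, fun m => ?_⟩
    · obtain ⟨m', h'⟩ := hy.1 m
      obtain ⟨m'', h''⟩ := hx.1 m'
      exact ⟨m'', by rw [Equiv.Perm.coe_mul, Set.image_comp, h', h'']⟩
    · obtain ⟨m', h'⟩ := hx.2 m
      obtain ⟨m'', h''⟩ := hy.2 m'
      exact ⟨m'', by rw [mul_inv_rev, Equiv.Perm.coe_mul, Set.image_comp, h', h'']⟩
  | inv x _ hx => exact ⟨hx.2, by simpa using hx.1⟩

theorem IsReflectingHyperplane.exists_eq_rootHyperplane {H : Set Exponents}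
    (h : IsReflectingHyperplane H) : ∃ m, H = rootHyperplane m := by
  obtain ⟨w, hw, i, rfl⟩ := h
  rw [setOf_eq_zero_eq_rootHyperplane]
  exact (exists_image_rootHyperplane hw).1 _

/-- The integral linear forms that define reflecting hyperplanes. -/
def IsRoot (a b c d e : ℤ) : Prop := IsReflectingHyperplane (rootHyperplane ![a, b, c, d, e])

theorem IsReflectingHyperplane.reflect {m : Fin 5 → ℤ}
    (h : IsReflectingHyperplane (rootHyperplane m)) (i : Fin 5) :
    IsReflectingHyperplane (rootHyperplane (reflectRoot i m)) := by
  obtain ⟨w, hw, j, hj⟩ := h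
  refine ⟨basicReflection i * w, mul_mem (Subgroup.subset_closure ⟨i, rfl⟩) hw, j, ?_⟩
  rw [Equiv.Perm.coe_mul, Set.image_comp, ← hj, basicReflection_image_rootHyperplane]

theorem IsRoot.of_reflect {a b c d e : ℤ} (h : IsRoot a b c d e) (i : Fin 5)
    {a' b' c' d' e' : ℤ} (h' : ![a', b', c', d', e'] = reflectRoot i ![a, b, c, d, e]) :
    IsRoot a' b' c' d' e' := by
  rw [IsRoot, h']
  exact IsReflectingHyperplane.reflect h i

theorem IsRoot.reflect_zero {a b c d e : ℤ} (h : IsRoot a b c d e) :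
    IsRoot (b + c + d + e - a) b c d e := by
  refine h.of_reflect 0 ?_
  ext j
  fin_cases j <;> (simp [reflectRoot, cartanAffineD4, Fin.sum_univ_five]; try ring)

theorem IsRoot.reflect_one {a b c d e : ℤ} (h : IsRoot a b c d e) :
    IsRoot a (a - b) c d e := by
  refine h.of_reflect 1 ?_
  ext j
  fin_cases j <;> (simp [reflectRoot, cartanAffineD4, Fin.sum_univ_five]; try ring)

theorem IsRoot.reflect_two {a b c d e : ℤ} (h : IsRoot a b c d e) :
    IsRoot a b (a - c) d e := by
  refine h.of_reflect 2 ?_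
  ext j
  fin_cases j <;> (simp [reflectRoot, cartanAffineD4, Fin.sum_univ_five]; try ring)

theorem IsRoot.reflect_three {a b c d e : ℤ} (h : IsRoot a b c d e) :
    IsRoot a b c (a - d) e := by
  refine h.of_reflect 3 ?_
  ext j
  fin_cases j <;> (simp [reflectRoot, cartanAffineD4, Fin.sum_univ_five]; try ring)

theorem IsRoot.reflect_four {a b c d e : ℤ} (h : IsRoot a b c d e) :
    IsRoot a b c d (a - e) := by
  refine h.of_reflect 4 ?_
  ext j
  fin_cases j <;> (simp [reflectRoot, cartanAffineD4, Fin.sum_univ_five]; try ring)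

theorem IsRoot.reflect_leaves {a b c d e : ℤ} (h : IsRoot a b c d e) :
    IsRoot a (a - b) (a - c) (a - d) (a - e) :=
  h.reflect_one.reflect_two.reflect_three.reflect_four

/-- Translation of a root by a multiple of the null root. -/
theorem IsRoot.translate {a b c d e : ℤ} (h : IsRoot a b c d e) {k : ℤ}
    (hk : k = b + c + d + e - 2 * a) :
    IsRoot (a + 2 * k) (b + k) (c + k) (d + k) (e + k) := by
  have := h.reflect_zero.reflect_leaves.reflect_zero.reflect_leaves
  rw [hk]
  convert this using 1 <;> ring

theorem IsRoot.translate_neg {a b c d e : ℤ} (h : IsRoot a b c d e) {k : ℤ}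
    (hk : k = b + c + d + e - 2 * a) :
    IsRoot (a - 2 * k) (b - k) (c - k) (d - k) (e - k) := by
  have := h.reflect_leaves.reflect_zero.reflect_leaves.reflect_zero
  rw [hk]
  convert this using 1 <;> ring

/-- Adding the null root leaves `b + c + d + e - 2a` unchanged, so each translation step is again by
one null root. -/
theorem isRoot_leaf {b c d e : ℤ} (h : IsRoot 0 b c d e) (hs : b + c + d + e = 1) (n : ℤ) :
    IsRoot (2 * n) (b + n) (c + n) (d + n) (e + n) := by
  induction n using Int.induction_on with
  | zero => simpa using h
  | succ n ih =>
    convert ih.translate (k := 1) (by linarith) using 1 <;> ring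
  | pred n ih =>
    convert ih.translate_neg (k := 1) (by linarith) using 1 <;> ring

/-! ### The two families of reflecting hyperplanes that detect singular points. -/

theorem isReflectingHyperplane_basic (i : Fin 5) :
    IsReflectingHyperplane (rootHyperplane (Pi.single i 1)) :=
  ⟨1, one_mem _, i, by rw [← setOf_eq_zero_eq_rootHyperplane]; simp⟩

theorem isReflectingHyperplane_leaf {i : Fin 5} (hi : i ≠ 0) (n : ℤ) :
    IsReflectingHyperplane {κ : Exponents | κ i = n} := by
  have h := isReflectingHyperplane_basic i
  have key (b c d e : ℤ) (hm : (Pi.single i 1 : Fin 5 → ℤ) = ![0, b, c, d, e])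
      (hs : b + c + d + e = 1) : IsReflectingHyperplane {κ : Exponents | κ i = n} := by
    rw [hm] at h
    -- The null root takes the value 1 on `𝒦`, so subtracting it `n` times turns `κ i = 0` into `κ i
    -- = n`.
    have hr := isRoot_leaf h hs (-n)
    rw [IsRoot] at hr
    convert hr using 1
    ext κ
    have e1 : ∑ j, (((Pi.single i 1 : Fin 5 → ℤ) j : ℤ) : ℂ) * κ j = κ i := by
      simp [Pi.single_apply]
    rw [hm, Fin.sum_univ_five] at e1
    simp only [rootHyperplane, Set.mem_ofPred_eq, Fin.sum_univ_five]
    simp only [Matrix.cons_val] at e1 ⊢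
    push_cast at e1 ⊢
    have h2 := κ.2
    rw [← sub_eq_zero]
    refine Eq.congr ?_ rfl
    linear_combination -e1 + n * h2
  fin_cases i
  · exact absurd rfl hi
  · exact key 1 0 0 0 (by ext j; fin_cases j <;> rfl) (by norm_num)
  · exact key 0 1 0 0 (by ext j; fin_cases j <;> rfl) (by norm_num)
  · exact key 0 0 1 0 (by ext j; fin_cases j <;> rfl) (by norm_num)
  · exact key 0 0 0 1 (by ext j; fin_cases j <;> rfl) (by norm_num)

/-- The central reflection of a translated leaf root has central coefficient `1 + 2n`; each leaf
reflection then toggles its own coefficient between `n` and `1 + n`. -/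
theorem isRoot_center (n : ℤ) {x y z t : ℤ} (hx : x = 0 ∨ x = 1) (hy : y = 0 ∨ y = 1)
    (hz : z = 0 ∨ z = 1) (ht : t = 0 ∨ t = 1) :
    IsRoot (1 + 2 * n) (x + n) (y + n) (z + n) (t + n) := by
  have h : IsRoot 0 1 0 0 0 := by
    have := isReflectingHyperplane_basic 1
    rwa [show (Pi.single 1 1 : Fin 5 → ℤ) = ![0, 1, 0, 0, 0] by
      ext j; fin_cases j <;> rfl] at this
  have h1 : IsRoot (1 + 2 * n) (1 + n) (0 + n) (0 + n) (0 + n) := by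
    convert (isRoot_leaf h (by norm_num) n).reflect_zero using 1; ring
  have h2 : IsRoot (1 + 2 * n) (x + n) (0 + n) (0 + n) (0 + n) := by
    rcases hx with rfl | rfl
    · convert h1.reflect_one using 1; ring
    · exact h1
  have h3 : IsRoot (1 + 2 * n) (x + n) (y + n) (0 + n) (0 + n) := by
    rcases hy with rfl | rfl
    · exact h2
    · convert h2.reflect_two using 1; ring
  have h4 : IsRoot (1 + 2 * n) (x + n) (y + n) (z + n) (0 + n) := by
    rcases hz with rfl | rfl
    · exact h3
    · convert h3.reflect_three using 1; ring
  rcases ht with rfl | rfl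
  · exact h4
  · convert h4.reflect_four using 1; ring

theorem isReflectingHyperplane_center {x : Fin 4 → ℤ} (hx : ∀ i, x i = 0 ∨ x i = 1) (n : ℤ) :
    IsReflectingHyperplane {κ : Exponents | κ 0 + ∑ i, (x i : ℂ) * κ i.succ = n} := by
  have hr := isRoot_center (-n) (hx 0) (hx 1) (hx 2) (hx 3)
  rw [IsRoot] at hr
  convert hr using 1
  ext κ
  simp only [rootHyperplane, Set.mem_ofPred_eq, Fin.sum_univ_five, Fin.sum_univ_four]
  simp only [Matrix.cons_val, Fin.succ_zero_eq_one, Fin.succ_one_eq_two]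
  have h3 : (Fin.succ 2 : Fin 5) = 3 := rfl
  have h4 : (Fin.succ 3 : Fin 5) = 4 := rfl
  rw [h3, h4]
  push_cast
  have h2 := κ.2
  rw [← sub_eq_zero]
  refine Eq.congr ?_ rfl
  linear_combination n * h2

/-! ### Dynkin diagrams -/

theorem dynkinGraph_cartanAffineD4_adj (i j : Fin 5) :
    (dynkinGraph cartanAffineD4).Adj i j ↔ (i = 0 ∧ j ≠ 0) ∨ (i ≠ 0 ∧ j = 0) := by
  simp only [dynkinGraph, SimpleGraph.fromRel_adj]
  fin_cases i <;> fin_cases j <;> simp [cartanAffineD4]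

theorem subdiagram_adj {I : Finset (Fin 5)} (a b : (I : Set (Fin 5))) :
    (subdiagram I).Adj a b ↔ (a.1 = 0 ∧ b.1 ≠ 0) ∨ (a.1 ≠ 0 ∧ b.1 = 0) :=
  dynkinGraph_cartanAffineD4_adj a b

theorem subdiagram_connected {I : Finset (Fin 5)} (h0 : (0 : Fin 5) ∈ I) :
    (subdiagram I).Connected := by
  have h (a : (I : Set (Fin 5))) : (subdiagram I).Reachable a ⟨0, h0⟩ := by
    by_cases ha : a.1 = 0
    · rw [show a = ⟨0, h0⟩ from Subtype.ext ha]
    · exact SimpleGraph.Adj.reachable ((subdiagram_adj _ _).mpr (Or.inr ⟨ha, rfl⟩))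
  have : Nonempty (I : Set (Fin 5)) := ⟨⟨0, h0⟩⟩
  exact ⟨fun a b => (h a).trans (h b).symm⟩

theorem subdiagram_eq_bot {I : Finset (Fin 5)} (h0 : (0 : Fin 5) ∉ I) : subdiagram I = ⊥ := by
  ext a b
  rw [subdiagram_adj]
  have ha : a.1 ≠ 0 := fun h => h0 (h ▸ a.2)
  have hb : b.1 ≠ 0 := fun h => h0 (h ▸ b.2)
  simp [ha, hb]

/-- `Γ` is a star with centre `v`. -/
def IsStar {V : Type} (Γ : SimpleGraph V) (v : V) : Prop :=
  ∀ a b, Γ.Adj a b ↔ (a = v ∧ b ≠ v) ∨ (a ≠ v ∧ b = v)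

/-- `A₁`, `A₂`, `A₃` and `D₄` are the stars with 0 to 3 leaves, so this reduces identifying a
connected `D_I` to counting nodes. Any bijection works once a swap makes it match the centres. -/
theorem IsStar.nonempty_iso {V V' : Type} [Finite V] [Finite V'] {Γ : SimpleGraph V}
    {Γ' : SimpleGraph V'} {v : V} {v' : V'} (h : IsStar Γ v) (h' : IsStar Γ' v')
    (hc : Nat.card V = Nat.card V') : Nonempty (Γ ≃g Γ') := by
  classical
  obtain ⟨e⟩ : Nonempty (V ≃ V') := Finite.card_eq.mp hc
  set e' := e.trans (Equiv.swap (e v) v') with he'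
  have hv : e' v = v' := by simp [he']
  refine ⟨⟨e', fun {a b} => ?_⟩⟩
  rw [h, h', ← hv]
  simp

theorem isStar_subdiagram {I : Finset (Fin 5)} (h0 : (0 : Fin 5) ∈ I) :
    IsStar (subdiagram I) ⟨0, h0⟩ := by
  intro a b
  rw [subdiagram_adj]
  simp [Subtype.ext_iff]

theorem isStar_A1 : IsStar (ADE.A 1 le_rfl).diagram (0 : Fin 1) := by
  have h : IsStar (dynkinGraph (CartanMatrix.A 1)) 0 := by
    intro a b
    simp only [dynkinGraph, SimpleGraph.fromRel_adj]
    fin_cases a <;> fin_cases b <;> simp [CartanMatrix.A]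
  exact h

theorem isStar_A2 : IsStar (ADE.A 2 one_le_two).diagram (0 : Fin 2) := by
  have h : IsStar (dynkinGraph (CartanMatrix.A 2)) 0 := by
    intro a b
    simp only [dynkinGraph, SimpleGraph.fromRel_adj]
    fin_cases a <;> fin_cases b <;> simp [CartanMatrix.A]
  exact h

theorem isStar_A3 : IsStar (ADE.A 3 (by norm_num)).diagram (1 : Fin 3) := by
  have h : IsStar (dynkinGraph (CartanMatrix.A 3)) 1 := by
    intro a b
    simp only [dynkinGraph, SimpleGraph.fromRel_adj]
    fin_cases a <;> fin_cases b <;> simp [CartanMatrix.A]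
  exact h

theorem isStar_D4 : IsStar (ADE.D 4 le_rfl).diagram (1 : Fin 4) := by
  have h : IsStar (dynkinGraph (CartanMatrix.D 4)) 1 := by
    intro a b
    simp only [dynkinGraph, SimpleGraph.fromRel_adj]
    fin_cases a <;> fin_cases b <;> simp [CartanMatrix.D]
  exact h

theorem nonempty_subdiagram_iso {I : Finset (Fin 5)} (h0 : (0 : Fin 5) ∈ I) {T : ADE}
    {v : Fin T.rank} (hT : IsStar T.diagram v) (hc : I.card = T.rank) :
    Nonempty (subdiagram I ≃g T.diagram) :=
  (isStar_subdiagram h0).nonempty_iso hT (by simp [hc])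

section Components

variable {V : Type} {Γ : SimpleGraph V}

theorem nonempty_component_iso (h : Γ.Connected) (c : Γ.ConnectedComponent) :
    Nonempty (c.toSimpleGraph ≃g Γ) := by
  have hs : c.supp = Set.univ := by
    ext v
    simp only [SimpleGraph.ConnectedComponent.mem_supp_iff, Set.mem_univ, iff_true]
    have := h.preconnected.subsingleton_connectedComponent
    exact Subsingleton.elim _ _
  change Nonempty (Γ.induce c.supp ≃g Γ)
  rw [hs]
  exact ⟨SimpleGraph.induceUnivIso Γ⟩

theorem connectedComponentMk_bot_bijective :
    Function.Bijective (⊥ : SimpleGraph V).connectedComponentMk :=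
  ⟨fun a b h => by simpa [SimpleGraph.ConnectedComponent.eq] using h, Quot.mk_surjective⟩

theorem nonempty_component_bot_iso (c : (⊥ : SimpleGraph V).ConnectedComponent) :
    Nonempty (c.toSimpleGraph ≃g (ADE.A 1 le_rfl).diagram) := by
  obtain ⟨v, rfl⟩ := connectedComponentMk_bot_bijective.2 c
  have hu : ∀ w : ((⊥ : SimpleGraph V).connectedComponentMk v), w = ⟨v, rfl⟩ :=
    fun w => Subtype.ext (connectedComponentMk_bot_bijective.1 w.2)
  have : Subsingleton ((⊥ : SimpleGraph V).connectedComponentMk v) :=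
    ⟨fun a b => (hu a).trans (hu b).symm⟩
  refine IsStar.nonempty_iso (v := ⟨v, rfl⟩) (fun a b => ?_) isStar_A1 ?_
  · have hab : a = b := Subsingleton.elim a b
    subst hab
    simp
  · have : Nat.card ((⊥ : SimpleGraph V).connectedComponentMk v) = 1 :=
      Nat.card_eq_one_iff_unique.mpr ⟨inferInstance, ⟨⟨v, rfl⟩⟩⟩
    rw [this]
    simp [ADE.rank]

theorem hasDynkinType_singleton (h : Γ.Connected) {T : ADE} (e : Nonempty (Γ ≃g T.diagram)) :
    HasDynkinType Γ [T] := by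
  have := h.preconnected.subsingleton_connectedComponent
  have : Nonempty Γ.ConnectedComponent := h.nonempty.map Γ.connectedComponentMk
  obtain ⟨_⟩ := nonempty_unique Γ.ConnectedComponent
  refine ⟨Equiv.ofUnique Γ.ConnectedComponent (Fin 1), fun c => ?_⟩
  obtain ⟨i⟩ := nonempty_component_iso h c
  obtain ⟨e⟩ := e
  have : [T].get ((Equiv.ofUnique Γ.ConnectedComponent (Fin 1)) c) = T := by simp
  rw [this]
  exact ⟨i.trans e⟩

theorem hasDynkinType_replicate [Finite V] (h : Γ = ⊥) {n : ℕ} (hn : Nat.card V = n) :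
    HasDynkinType Γ (List.replicate n (.A 1 le_rfl)) := by
  subst h
  have hcard : Nat.card (⊥ : SimpleGraph V).ConnectedComponent =
      Nat.card (Fin (List.replicate n (ADE.A 1 le_rfl)).length) := by
    rw [← Nat.card_eq_of_bijective _ connectedComponentMk_bot_bijective, hn]
    simp
  have : Finite (⊥ : SimpleGraph V).ConnectedComponent :=
    Finite.of_surjective _ connectedComponentMk_bot_bijective.2
  obtain ⟨e⟩ := Finite.card_eq.mp hcard
  refine ⟨e, fun c => ?_⟩
  rw [List.get_eq_getElem, List.getElem_replicate]
  exact nonempty_component_bot_iso c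

theorem hasSimpleSingularitiesOfType_of_connected {f : (Fin 3 → ℂ) → ℂ} (h : Γ.Connected) {T : ADE}
    (e : Nonempty (Γ ≃g T.diagram)) {p : Fin 3 → ℂ} (hp : IsSingularPoint f p)
    (hu : ∀ q, IsSingularPoint f q → q = p) (hT : HasSimpleSingularityAt f p T) :
    HasSimpleSingularitiesOfType f Γ := by
  have := h.preconnected.subsingleton_connectedComponent
  have : Nonempty Γ.ConnectedComponent := h.nonempty.map Γ.connectedComponentMk
  obtain ⟨_⟩ := nonempty_unique Γ.ConnectedComponent
  have : Unique {p : Fin 3 → ℂ // IsSingularPoint f p} :=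
    ⟨⟨⟨p, hp⟩⟩, fun q => Subtype.ext (hu q q.2)⟩
  refine ⟨Equiv.ofUnique _ _, fun c => ⟨T, ?_, ?_⟩⟩
  · obtain ⟨i⟩ := nonempty_component_iso h c
    obtain ⟨e⟩ := e
    exact ⟨i.trans e⟩
  · have : ((Equiv.ofUnique Γ.ConnectedComponent {p : Fin 3 → ℂ // IsSingularPoint f p}) c).1 = p :=
      hu _ (Subtype.prop _)
    rw [this]
    exact hT

theorem hasSimpleSingularitiesOfType_of_eq_bot {f : (Fin 3 → ℂ) → ℂ} (h : Γ = ⊥)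
    (F : V → {p : Fin 3 → ℂ // IsSingularPoint f p}) (hF : Function.Bijective F)
    (hT : ∀ v, HasSimpleSingularityAt f (F v) (.A 1 le_rfl)) :
    HasSimpleSingularitiesOfType f Γ := by
  subst h
  refine ⟨(Equiv.ofBijective _ connectedComponentMk_bot_bijective).symm.trans
    (Equiv.ofBijective F hF), fun c => ⟨_, nonempty_component_bot_iso c, ?_⟩⟩
  exact hT _

end Components

theorem hasDynkinType_subdiagram_of_mem {I : Finset (Fin 5)} (h0 : (0 : Fin 5) ∈ I) {T : ADE}
    {v : Fin T.rank} (hT : IsStar T.diagram v) (hc : I.card = T.rank) :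
    HasDynkinType (subdiagram I) [T] :=
  hasDynkinType_singleton (subdiagram_connected h0) (nonempty_subdiagram_iso h0 hT hc)

theorem hasDynkinType_subdiagram_of_notMem {I : Finset (Fin 5)} (h0 : (0 : Fin 5) ∉ I) {n : ℕ}
    (hc : I.card = n) :
    HasDynkinType (subdiagram I) (List.replicate n (.A 1 le_rfl)) :=
  hasDynkinType_replicate (subdiagram_eq_bot h0) (by simp [hc])

theorem exists_hasDynkinType_subdiagram {I : Finset (Fin 5)} (hI : I.Nonempty)
    (hI' : I ≠ Finset.univ) : ∃ l ∈ possibleTypes, HasDynkinType (subdiagram I) l := by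
  have h1 : 1 ≤ I.card := hI.card_pos
  have h2 : I.card < 5 := by
    simpa using Finset.card_lt_card (Finset.ssubset_univ_iff.mpr hI')
  by_cases h0 : (0 : Fin 5) ∈ I
  · have : I.card = 1 ∨ I.card = 2 ∨ I.card = 3 ∨ I.card = 4 := by omega
    rcases this with h | h | h | h
    · exact ⟨_, by simp [possibleTypes], hasDynkinType_subdiagram_of_mem h0 isStar_A1 h⟩
    · exact ⟨_, by simp [possibleTypes], hasDynkinType_subdiagram_of_mem h0 isStar_A2 h⟩
    · exact ⟨_, by simp [possibleTypes], hasDynkinType_subdiagram_of_mem h0 isStar_A3 h⟩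
    · exact ⟨_, by simp [possibleTypes], hasDynkinType_subdiagram_of_mem h0 isStar_D4 h⟩
  · refine ⟨_, ?_, hasDynkinType_subdiagram_of_notMem h0 rfl⟩
    have : I.card = 1 ∨ I.card = 2 ∨ I.card = 3 ∨ I.card = 4 := by omega
    rcases this with h | h | h | h <;> simp [possibleTypes, h]

/-! ### Generic points of the flats -/

/-- The points of a flat that lie on no reflecting hyperplanes other than those containing the
flat. -/
def IsGenericPoint (I : Finset (Fin 5)) (κ : Exponents) : Prop :=
  κ ∈ flat I ∧ ∀ H, IsReflectingHyperplane H → κ ∈ H → flat I ⊆ H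

/-- The coefficients of the null root. -/
def mark : Fin 5 → ℂ := ![2, 1, 1, 1, 1]

theorem mark_of_ne_zero {i : Fin 5} (hi : i ≠ 0) : mark i = 1 := by
  fin_cases i <;> simp_all [mark]

/-- A point with prescribed `i`-th coordinate whose only other nonzero coordinate is the `j`-th. -/
theorem exists_exponents_of_pair {i j : Fin 5} (hij : i ≠ j) (t : ℂ) :
    ∃ κ : Exponents, κ i = t ∧ κ j = (1 - mark i * t) / mark j ∧
      ∀ k, k ≠ i → k ≠ j → κ k = 0 := by
  refine ⟨⟨fun k => if k = i then t else if k = j then (1 - mark i * t) / mark j else 0, ?_⟩,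
    ?_, ?_, ?_⟩
  · fin_cases i <;> fin_cases j <;> simp [mark] at hij ⊢ <;> ring
  · simp
  · simp [hij.symm]
  · intro k hi hj
    simp [hi, hj]

theorem mem_flat_of_pair {I : Finset (Fin 5)} {i j : Fin 5} (hi : i ∉ I) (hj : j ∉ I)
    {κ : Exponents} (h : ∀ k, k ≠ i → k ≠ j → κ k = 0) : κ ∈ flat I :=
  fun k hk => h k (fun e => hi (e ▸ hk)) (fun e => hj (e ▸ hk))

variable {I : Finset (Fin 5)} {κ : Exponents}

/-- If `i` and another node `j` are both outside `I`, then `κ i` varies freely on the flat with `κ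
j` compensating. If `i` alone is outside, the affine relation fixes `κ i`, hence the second
alternative. -/
theorem IsGenericPoint.leaf (h : IsGenericPoint I κ) {i : Fin 5} (hi : i ≠ 0) {n : ℤ}
    (hn : κ i = n) : i ∈ I ∨ ∀ j, j ≠ i → j ∈ I := by
  by_contra! hc
  obtain ⟨hiI, j, hji, hjI⟩ := hc
  obtain ⟨κ', h1, -, h3⟩ := exists_exponents_of_pair hji.symm ((n : ℂ) + 1)
  have : κ' i = n := h.2 _ (isReflectingHyperplane_leaf hi n) hn (mem_flat_of_pair hiI hjI h3)
  rw [h1] at this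
  simp at this

/-- If `0 ∉ I`, the flat contains the point with `κ 0 = 1/2` and zero leaves, where the form is not
an integer. If `x` takes both values on the leaves outside `I`, trading weight between two such
leaves changes the form along the flat. -/
theorem IsGenericPoint.center (h : IsGenericPoint I κ) {x : Fin 4 → ℤ}
    (hx : ∀ i, x i = 0 ∨ x i = 1) {n : ℤ} (hn : κ 0 + ∑ i, (x i : ℂ) * κ i.succ = n) :
    (0 : Fin 5) ∈ I ∧
      ((∀ i : Fin 4, i.succ ∉ I → x i = 0) ∨ (∀ i : Fin 4, i.succ ∉ I → x i = 1)) := by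
  have hH (κ' : Exponents) (hκ' : κ' ∈ flat I) : κ' 0 + ∑ i, (x i : ℂ) * κ' i.succ = n :=
    h.2 _ (isReflectingHyperplane_center hx n) hn hκ'
  have hI0 : (0 : Fin 5) ∈ I := by
    by_contra h0
    have key (i : Fin 4) (t : ℂ) (ht : i.succ ∉ I ∨ t = 0) :
        (1 - t) / 2 + x i * t = n := by
      obtain ⟨κ', h1, h2, h3⟩ := exists_exponents_of_pair (Fin.succ_ne_zero i) t
      have hf : κ' ∈ flat I := by
        intro k hk
        by_cases hki : k = i.succ
        · rcases ht with ht | ht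
          · exact absurd (hki ▸ hk) ht
          · rw [hki, h1, ht]
        · exact h3 k hki (fun e => h0 (e ▸ hk))
      have := hH κ' hf
      rw [Finset.sum_eq_single i, h1, h2, mark_of_ne_zero (Fin.succ_ne_zero i)] at this
      · simpa [mark] using this
      · intro j _ hj
        rw [h3 _ (fun e => hj (Fin.succ_injective _ e)) (Fin.succ_ne_zero j), mul_zero]
      · simp
    have e1 := key 0 0 (Or.inr rfl)
    have e2 : (1 : ℂ) = 2 * n := by linear_combination 2 * e1
    have e3 : (1 : ℤ) = 2 * n := by exact_mod_cast e2
    omega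
  refine ⟨hI0, ?_⟩
  by_contra! hc
  obtain ⟨⟨i, hiI, hi⟩, j, hjI, hj⟩ := hc
  have hi1 := (hx i).resolve_left hi
  have hj0 := (hx j).resolve_right hj
  have hij : i ≠ j := by rintro rfl; exact hj hi1
  obtain ⟨κ', h1, h2, h3⟩ := exists_exponents_of_pair
    (fun e => hij (Fin.succ_injective _ e) : i.succ ≠ j.succ) ((n : ℂ) + 1)
  have := hH κ' (mem_flat_of_pair hiI hjI h3)
  rw [h3 0 (Fin.succ_ne_zero i).symm (Fin.succ_ne_zero j).symm, Finset.sum_eq_single i, h1,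
    hi1] at this
  · simp at this
  · intro k _ hk
    by_cases hkj : k = j
    · rw [hkj, hj0]; simp
    · rw [h3 _ (fun e => hk (Fin.succ_injective _ e)) (fun e => hkj (Fin.succ_injective _ e)),
        mul_zero]
  · simp

/-! ### Eigenvalue relations as integrality conditions on exponents. -/

theorem eigenvalue_sq (κ : Exponents) (i : Fin 4) :
    eigenvalue κ i ^ 2 = Complex.exp (κ i.succ * (2 * Real.pi * Complex.I)) := by
  fin_cases i <;> simp [eigenvalue, ← Complex.exp_nat_mul] <;> congr 1 <;> ring_nf

theorem eigenvalue_sq_eq_one_iff (κ : Exponents) (i : Fin 4) :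
    eigenvalue κ i ^ 2 = 1 ↔ ∃ n : ℤ, κ i.succ = n := by
  rw [eigenvalue_sq, Complex.exp_eq_one_iff]
  have : (2 * Real.pi * Complex.I : ℂ) ≠ 0 := Complex.two_pi_I_ne_zero
  refine exists_congr fun n => ?_
  rw [mul_left_inj' this]

/-- With `x i = 1` marking an inverted eigenvalue and the sign of the fourth counted as `exp(πi)`,
the affine relation makes the total exponent `2πi` times `1 - (κ 0 + ∑ x i * κ i.succ)`. -/
theorem exists_center_of_eigenvalue_prod {β : Fin 4 → ℂ}
    (hβ : ∀ i, β i = eigenvalue κ i ∨ β i = (eigenvalue κ i)⁻¹)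
    (h : β 0 * β 1 * β 2 * β 3 = 1) :
    ∃ (x : Fin 4 → ℤ) (n : ℤ),
      (∀ i, (x i = 0 ∧ β i = eigenvalue κ i) ∨ (x i = 1 ∧ β i = (eigenvalue κ i)⁻¹)) ∧
        κ 0 + ∑ i, (x i : ℂ) * κ i.succ = n := by
  have hx (i : Fin 4) : ∃ x : ℤ,
      (x = 0 ∧ β i = eigenvalue κ i) ∨ (x = 1 ∧ β i = (eigenvalue κ i)⁻¹) := by
    rcases hβ i with h | h
    · exact ⟨0, Or.inl ⟨rfl, h⟩⟩
    · exact ⟨1, Or.inr ⟨rfl, h⟩⟩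
  choose x hx using hx
  have hb (i : Fin 4) : β i = (if i = 3 then -1 else 1) *
      Complex.exp (Real.pi * Complex.I * ((1 - 2 * x i) * κ i.succ)) := by
    have hpos : eigenvalue κ i = (if i = 3 then -1 else 1) *
        Complex.exp (Real.pi * Complex.I * κ i.succ) := by
      fin_cases i <;> simp [eigenvalue]
    rcases hx i with ⟨h0, h1⟩ | ⟨h0, h1⟩
    · rw [h1, h0, hpos]; simp
    · rw [h1, h0, hpos, mul_inv, ← Complex.exp_neg]
      congr 1
      · split_ifs <;> norm_num
      · congr 1; push_cast; ring
  rw [hb 0, hb 1, hb 2, hb 3] at h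
  have h' : Complex.exp (-(κ 0 + ∑ i, (x i : ℂ) * κ i.succ) * (2 * Real.pi * Complex.I)) = 1 := by
    refine Eq.trans ?_ h
    simp only [Fin.reduceEq, if_false, if_true, one_mul, neg_mul, mul_neg, ← Complex.exp_add]
    rw [← neg_one_mul (Complex.exp _), ← Complex.exp_pi_mul_I, ← Complex.exp_add,
      Complex.exp_eq_exp_iff_exists_int]
    refine ⟨-1, ?_⟩
    have hκ := κ.2
    simp only [Fin.sum_univ_four]
    push_cast
    linear_combination (-Real.pi * Complex.I) * hκ
  obtain ⟨n, hn⟩ := Complex.exp_eq_one_iff.mp h'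
  refine ⟨x, -n, hx, ?_⟩
  have := mul_right_cancel₀ Complex.two_pi_I_ne_zero hn
  push_cast
  linear_combination -this

theorem localMonodromy_sq_eq_four_iff (κ : Exponents) (i : Fin 4) :
    localMonodromy κ i ^ 2 = 4 ↔ eigenvalue κ i ^ 2 = 1 := by
  have hb := eigenvalue_ne_zero κ i
  rw [localMonodromy_eq]
  generalize eigenvalue κ i = b at hb ⊢
  constructor
  · intro h
    have : (b ^ 2 - 1) ^ 2 = 0 := by
      field_simp at h
      linear_combination h
    exact sub_eq_zero.mp (sq_eq_zero_iff.mp this)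
  · intro h
    rw [inv_eq_of_mul_eq_one_right (by rw [← sq]; exact h)]
    linear_combination 4 * h

/-! ### Flats not in the central wall: nodes -/

/-- The two points always share the coordinate `a l * a l' / 2 = 2η`, `η = ±1`, and there the
Hessian is minus the square of one remaining coordinate minus `η` times the other. Coincidence makes
that difference vanish. -/
theorem hessianForm_eq_zero_of_scalarPoint_eq {a : Fin 4 → ℂ} {l l' : Fin 4} (h : a l ^ 2 = 4)
    (h' : a l' ^ 2 = 4) (hne : l ≠ l') (he : scalarPoint a l = scalarPoint a l') :
    hessianForm (scalarPoint a l) = 0 := by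
  have key {A B y z : ℂ} (hA : A ^ 2 = 4) (hB : B ^ 2 = 4) (hy : A / 2 * y = B / 2 * z) :
      (A / 2 * B) * (A / 2 * y) * (A / 2 * z) - (A / 2 * B) ^ 2 - (A / 2 * y) ^ 2
        - (A / 2 * z) ^ 2 + 4 = 0 := by
    linear_combination (B * z / 2 - A * y / 2) * hy
      + (A * B * y * z / 8 - B ^ 2 / 4 - z ^ 2 / 4) * hA
      + (z ^ 2 / 4 - 1) * hB
  have e0 := congrFun he 0
  have e1 := congrFun he 1
  have e2 := congrFun he 2
  fin_cases l <;> fin_cases l' <;> simp [scalarPoint, hessianForm] at h h' hne e0 e1 e2 ⊢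
  · linear_combination key h h' e0
  · linear_combination key h h' e2
  · linear_combination key h h' e1
  · linear_combination key h h' e0
  · linear_combination key h h' e1
  · linear_combination key h h' e2
  · linear_combination key h h' e2
  · linear_combination key h h' e1
  · linear_combination key h h' e0
  · linear_combination key h h' e1
  · linear_combination key h h' e2
  · linear_combination key h h' e0

theorem hasSimpleSingularitiesOfType_of_notMem (h : IsGenericPoint I κ) (h0 : (0 : Fin 5) ∉ I) :
    HasSimpleSingularitiesOfType (cubic (rh κ)) (subdiagram I) := by
  have hb := eigenvalue_ne_zero κ
  have ha := localMonodromy_eq κ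
  have hβ : ∀ β : Fin 4 → ℂ, (∀ i, β i = eigenvalue κ i ∨ β i = (eigenvalue κ i)⁻¹) →
      β 0 * β 1 * β 2 * β 3 ≠ 1 := by
    intro β hβ hprod
    obtain ⟨x, n, hx, hn⟩ := exists_center_of_eigenvalue_prod hβ hprod
    exact h0 (h.center (fun i => (hx i).imp And.left And.left) hn).1
  have hl (l : Fin 4) : localMonodromy κ l ^ 2 = 4 ↔ l.succ ∈ I := by
    rw [localMonodromy_sq_eq_four_iff, eigenvalue_sq_eq_one_iff]
    constructor
    · rintro ⟨n, hn⟩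
      exact (h.leaf (Fin.succ_ne_zero l) hn).resolve_right
        fun hj => h0 (hj 0 (Fin.succ_ne_zero l).symm)
    · intro hI
      exact ⟨0, by simpa using h.1 _ hI⟩
  have hpred (v : (I : Set (Fin 5))) : ∃ l : Fin 4, l.succ = v.1 :=
    Fin.exists_succ_eq.mpr fun e => h0 (e ▸ v.2)
  choose l hlv using hpred
  have hal (v : (I : Set (Fin 5))) : localMonodromy κ (l v) ^ 2 = 4 := by
    rw [hl, hlv]; exact v.2
  refine hasSimpleSingularitiesOfType_of_eq_bot (subdiagram_eq_bot h0)
    (fun v => ⟨scalarPoint (localMonodromy κ) (l v), isSingularPoint_scalarPoint (hal v)⟩)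
    ⟨fun v w hvw => ?_, fun q => ?_⟩ fun v => ?_
  · by_contra hne
    refine hessianForm_scalarPoint_ne_zero hb ha hβ (hal v)
      (hessianForm_eq_zero_of_scalarPoint_eq (hal v) (hal w) (fun e => hne ?_)
        (congrArg Subtype.val hvw))
    exact Subtype.ext (by rw [← hlv v, ← hlv w, e])
  · rcases eq_scalarPoint_or_eq_reduciblePoint hb ha q.2 with ⟨k, hk, hq⟩ | ⟨β, hβ1, hβ2, -⟩
    · refine ⟨⟨k.succ, (hl k).mp hk⟩, Subtype.ext ?_⟩
      have : l ⟨k.succ, (hl k).mp hk⟩ = k := Fin.succ_injective _ (hlv _)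
      simp only [this]
      exact hq.symm
    · exact absurd hβ2 (hβ β hβ1)
  · exact hasSimpleSingularityAt_A1_of_hessianForm_ne_zero (isSingularPoint_scalarPoint (hal v))
      (hessianForm_scalarPoint_ne_zero hb ha hβ (hal v))

/-! ### Flats in the central wall: a single singular point -/

theorem reduciblePoint_sq_eq_four_iff {β : Fin 4 → ℂ} (h : β 0 * β 1 * β 2 * β 3 = 1) :
    (reduciblePoint β 0 ^ 2 = 4 ↔ β 1 ^ 2 * β 2 ^ 2 = 1) ∧
    (reduciblePoint β 1 ^ 2 = 4 ↔ β 0 ^ 2 * β 2 ^ 2 = 1) ∧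
    (reduciblePoint β 2 ^ 2 = 4 ↔ β 0 ^ 2 * β 1 ^ 2 = 1) := by
  have h0 : β 0 ≠ 0 := by rintro h0; simp [h0] at h
  have h1 : β 1 ≠ 0 := by rintro h0; simp [h0] at h
  have h2 : β 2 ≠ 0 := by rintro h0; simp [h0] at h
  have key {z : ℂ} (hz : z ≠ 0) : (z + z⁻¹) ^ 2 = 4 ↔ z ^ 2 = 1 := by
    constructor
    · intro h
      have : (z ^ 2 - 1) ^ 2 = 0 := by
        field_simp at h
        linear_combination h
      exact sub_eq_zero.mp (sq_eq_zero_iff.mp this)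
    · intro h
      rw [inv_eq_of_mul_eq_one_right (by rw [← sq]; exact h)]
      linear_combination 4 * h
  simp only [← mul_pow]
  exact ⟨key (mul_ne_zero h1 h2), key (mul_ne_zero h0 h2), key (mul_ne_zero h0 h1)⟩

/-- As the product is one, each coordinate of the reducible point can be computed from either of two
complementary pairs; the pair containing `l` gives `β l * a j`, because `β l = ±1`. -/
theorem scalarPoint_eq_reduciblePoint {a β : Fin 4 → ℂ} (ha : ∀ i, a i = β i + (β i)⁻¹)
    (h : β 0 * β 1 * β 2 * β 3 = 1) {l : Fin 4} (hl : β l ^ 2 = 1) :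
    scalarPoint a l = reduciblePoint β := by
  have h0 : β 0 ≠ 0 := by rintro h0; simp [h0] at h
  have h1 : β 1 ≠ 0 := by rintro h0; simp [h0] at h
  have h2 : β 2 ≠ 0 := by rintro h0; simp [h0] at h
  have h3 : β 3 ≠ 0 := by rintro h0; simp [h0] at h
  have hal : a l / 2 = β l := by
    rw [ha, inv_eq_of_mul_eq_one_right (by rw [← sq]; exact hl)]; ring
  ext i
  rw [scalarPoint, Pi.smul_apply, smul_eq_mul, hal]
  fin_cases l <;> fin_cases i <;>
    simp only [Fin.zero_eta, Fin.mk_one, Fin.reduceFinMk] at hl <;>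
    simp [reduciblePoint, ha] <;> field_simp
  · linear_combination (β 3 - β 0 * β 1 * β 2) * h + β 3 * β 1 ^ 2 * β 2 ^ 2 * hl
  · linear_combination hl
  · linear_combination hl
  · linear_combination hl
  · linear_combination (β 3 - β 1 * β 0 * β 2) * h + β 3 * β 0 ^ 2 * β 2 ^ 2 * hl
  · linear_combination hl
  · linear_combination hl
  · linear_combination hl
  · linear_combination (β 3 - β 2 * β 0 * β 1) * h + β 3 * β 0 ^ 2 * β 1 ^ 2 * hl
  · linear_combination (β 0 - β 3 * β 1 * β 2) * h + β 0 * β 1 ^ 2 * β 2 ^ 2 * hl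
  · linear_combination (β 1 - β 3 * β 0 * β 2) * h + β 1 * β 0 ^ 2 * β 2 ^ 2 * hl
  · linear_combination (β 2 - β 3 * β 0 * β 1) * h + β 2 * β 0 ^ 2 * β 1 ^ 2 * hl

theorem reduciblePoint_inv (β : Fin 4 → ℂ) :
    reduciblePoint (fun i => (β i)⁻¹) = reduciblePoint β := by
  ext i
  fin_cases i <;> simp [reduciblePoint, add_comm, mul_comm]

theorem IsGenericPoint.eigenvalue_sq_eq_one_iff (h : IsGenericPoint I κ) (h0 : (0 : Fin 5) ∈ I)
    (i : Fin 4) : eigenvalue κ i ^ 2 = 1 ↔ i.succ ∈ I ∨ ∀ j : Fin 4, j ≠ i → j.succ ∈ I := by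
  have hI {j : Fin 4} (hj : j.succ ∈ I) : eigenvalue κ j ^ 2 = 1 :=
    (PainleveVI.eigenvalue_sq_eq_one_iff κ j).mpr ⟨0, by simpa using h.1 _ hj⟩
  constructor
  · intro he
    obtain ⟨n, hn⟩ := (PainleveVI.eigenvalue_sq_eq_one_iff κ i).mp he
    exact (h.leaf (Fin.succ_ne_zero i) hn).imp_right
      fun hj j hji => hj _ fun e => hji (Fin.succ_injective _ e)
  · rintro (hi | hi)
    · exact hI hi
    · rw [PainleveVI.eigenvalue_sq_eq_one_iff]
      have hz (j : Fin 4) (hj : j ≠ i) : κ j.succ = 0 := h.1 _ (hi j hj)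
      have hκ0 : κ 0 = 0 := h.1 _ h0
      have hκ : 2 * κ 0 + ∑ j : Fin 4, κ j.succ = 1 := by
        rw [Fin.sum_univ_four]
        exact Eq.trans (by simp only [add_assoc]; rfl) κ.2
      rw [hκ0, Finset.sum_eq_single i (fun j _ hj => hz j hj) (by simp)] at hκ
      exact ⟨1, by simpa using hκ⟩

theorem IsGenericPoint.eigenvalue_prod (h : IsGenericPoint I κ) (h0 : (0 : Fin 5) ∈ I) :
    eigenvalue κ 0 * eigenvalue κ 1 * eigenvalue κ 2 * eigenvalue κ 3 = 1 := by
  have := central_sq_mul_eigenvalue κ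
  rw [h.1 0 h0] at this
  simpa using this

/-- Inverting an eigenvalue at a leaf in `I` changes nothing, and outside `I` genericity allows only
inverting all or none. The point is unchanged when all eigenvalues are inverted, so every reducible
point is this one; scalar points coincide with it too. -/
theorem IsGenericPoint.eq_reduciblePoint (h : IsGenericPoint I κ) (h0 : (0 : Fin 5) ∈ I)
    {q : Fin 3 → ℂ} (hq : IsSingularPoint (cubic (rh κ)) q) :
    q = reduciblePoint (eigenvalue κ) := by
  rcases eq_scalarPoint_or_eq_reduciblePoint (eigenvalue_ne_zero κ) (localMonodromy_eq κ) hq with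
    ⟨l, hl, rfl⟩ | ⟨β, hβ1, hβ2, rfl⟩
  · rw [localMonodromy_sq_eq_four_iff] at hl
    exact scalarPoint_eq_reduciblePoint (localMonodromy_eq κ) (h.eigenvalue_prod h0) hl
  · obtain ⟨x, n, hx, hn⟩ := exists_center_of_eigenvalue_prod hβ1 hβ2
    have hinv (i : Fin 4) (hi : i.succ ∈ I) : (eigenvalue κ i)⁻¹ = eigenvalue κ i :=
      inv_eq_of_mul_eq_one_right
        (by rw [← sq]; exact (h.eigenvalue_sq_eq_one_iff h0 i).mpr (Or.inl hi))
    rcases (h.center (fun i => (hx i).imp And.left And.left) hn).2 with hc | hc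
    · congr 1
      ext i
      by_cases hi : i.succ ∈ I
      · exact (hβ1 i).elim id fun e => e.trans (hinv i hi)
      · rcases hx i with ⟨-, h2⟩ | ⟨h1, -⟩
        · exact h2
        · rw [hc i hi] at h1; exact absurd h1 (by norm_num)
    · rw [← reduciblePoint_inv (eigenvalue κ)]
      congr 1
      ext i
      by_cases hi : i.succ ∈ I
      · exact (hβ1 i).elim (fun e => e.trans (hinv i hi).symm) id
      · rcases hx i with ⟨h1, -⟩ | ⟨-, h2⟩
        · rw [hc i hi] at h1; exact absurd h1 (by norm_num)
        · exact h2

/-- The indices of the leaves in `I`. -/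
def leaves (I : Finset (Fin 5)) : Finset (Fin 4) := Finset.univ.filter fun i => i.succ ∈ I

theorem card_leaves (h0 : (0 : Fin 5) ∈ I) : (leaves I).card + 1 = I.card := by
  have : I = insert 0 ((leaves I).map (Fin.succEmb 4)) := by
    ext i
    refine Fin.cases ?_ (fun j => ?_) i
    · simp [h0]
    · simp [leaves, Fin.succ_ne_zero]
  rw [this, Finset.card_insert_of_notMem, Finset.card_map]
  · congr 2
    ext i
    simp [leaves, Fin.succ_ne_zero]
  · simp [Fin.succ_ne_zero]

theorem IsGenericPoint.eigenvalue_sq_eq_one_iff_mem (h : IsGenericPoint I κ)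
    (h0 : (0 : Fin 5) ∈ I) (hc : I.card ≤ 3) (i : Fin 4) :
    eigenvalue κ i ^ 2 = 1 ↔ i ∈ leaves I := by
  rw [h.eigenvalue_sq_eq_one_iff h0, leaves, Finset.mem_filter]
  simp only [Finset.mem_univ, true_and, or_iff_left_iff_imp]
  -- All other leaves together with the centre would give `I` at least four nodes. That case is
  -- excluded here because the last leaf then has `κ i = 1` or 0, and all four eigenvalues are `±1`.
  intro hj
  exfalso
  have : (Finset.univ.erase i) ⊆ leaves I := by
    intro j hj'
    simpa [leaves] using hj j (Finset.ne_of_mem_erase hj')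
  have h1 := Finset.card_le_card this
  have h2 := card_leaves h0
  rw [Finset.card_erase_of_mem (Finset.mem_univ i)] at h1
  simp at h1
  omega

theorem sq_mul_sq_eq_one {β : Fin 4 → ℂ} (h : β 0 * β 1 * β 2 * β 3 = 1) :
    β 0 ^ 2 * β 1 ^ 2 * β 2 ^ 2 * β 3 ^ 2 = 1 := by
  rw [← mul_pow, ← mul_pow, ← mul_pow, h, one_pow]

theorem hessianForm_reduciblePoint_eq_zero_iff {β : Fin 4 → ℂ}
    (h : β 0 * β 1 * β 2 * β 3 = 1) :
    hessianForm (reduciblePoint β) = 0 ↔ ∃ i, β i ^ 2 = 1 := by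
  have h0 (i : Fin 4) : β i ≠ 0 := by
    intro h0; fin_cases i <;> simp at h0 <;> simp [h0] at h
  have key (i : Fin 4) : β i - (β i)⁻¹ = 0 ↔ β i ^ 2 = 1 := by
    have := h0 i
    rw [sub_eq_zero, sq]
    exact (mul_eq_one_iff_eq_inv₀ this).symm
  rw [hessianForm_reduciblePoint h, mul_eq_zero, mul_eq_zero, mul_eq_zero, neg_eq_zero,
    key, key, key, key, Fin.exists_fin_succ, Fin.exists_fin_succ, Fin.exists_fin_succ,
    Fin.exists_fin_succ]
  simp [or_assoc]

theorem reduciblePoint_sq_eq_four_iff' {β : Fin 4 → ℂ} (h : β 0 * β 1 * β 2 * β 3 = 1) :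
    (reduciblePoint β 0 ^ 2 = 4 ↔ β 0 ^ 2 * β 3 ^ 2 = 1) ∧
    (reduciblePoint β 1 ^ 2 = 4 ↔ β 1 ^ 2 * β 3 ^ 2 = 1) ∧
    (reduciblePoint β 2 ^ 2 = 4 ↔ β 2 ^ 2 * β 3 ^ 2 = 1) := by
  have key {x y : ℂ} (hxy : x * y = 1) : x = 1 ↔ y = 1 := by
    constructor <;> rintro rfl <;> simpa using hxy
  have hsq := sq_mul_sq_eq_one h
  obtain ⟨h0, h1, h2⟩ := reduciblePoint_sq_eq_four_iff h
  rw [h0, h1, h2]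
  exact ⟨key (by linear_combination hsq), key (by linear_combination hsq),
    key (by linear_combination hsq)⟩

theorem exists_reduciblePoint_sq_eq_four_iff {β : Fin 4 → ℂ} (h : β 0 * β 1 * β 2 * β 3 = 1)
    {i j : Fin 4} (hij : i ≠ j) :
    ∃ k, reduciblePoint β k ^ 2 = 4 ↔ β i ^ 2 * β j ^ 2 = 1 := by
  obtain ⟨h0, h1, h2⟩ := reduciblePoint_sq_eq_four_iff h
  obtain ⟨h0', h1', h2'⟩ := reduciblePoint_sq_eq_four_iff' h
  wlog hlt : i < j generalizing i j
  · obtain ⟨k, hk⟩ := this hij.symm (lt_of_le_of_ne (not_lt.mp hlt) hij.symm)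
    exact ⟨k, by rwa [mul_comm]⟩
  fin_cases i <;> fin_cases j <;> simp at hlt
  exacts [⟨2, h2⟩, ⟨1, h1⟩, ⟨0, h0'⟩, ⟨0, h0⟩, ⟨1, h1'⟩, ⟨2, h2'⟩]

/-- Each coordinate is tied to two complementary pairs of indices, one of which contains `i`. For
that pair the product of squares is the square of the other eigenvalue, which is not one. -/
theorem reduciblePoint_sq_ne_four {β : Fin 4 → ℂ} (h : β 0 * β 1 * β 2 * β 3 = 1) {i : Fin 4}
    (he : ∀ j, β j ^ 2 = 1 ↔ j = i) (k : Fin 3) : reduciblePoint β k ^ 2 ≠ 4 := by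
  obtain ⟨h0, h1, h2⟩ := reduciblePoint_sq_eq_four_iff h
  obtain ⟨h0', h1', h2'⟩ := reduciblePoint_sq_eq_four_iff' h
  have hl {x y : Fin 4} (hxy : x ≠ y) (hp : β x ^ 2 * β y ^ 2 = 1) : i ≠ x ∧ i ≠ y := by
    constructor
    · rintro rfl
      rw [(he i).mpr rfl, one_mul, he] at hp
      exact hxy hp.symm
    · rintro rfl
      rw [(he i).mpr rfl, mul_one, he] at hp
      exact hxy hp
  intro hk
  fin_cases k
  · have e1 := hl (by decide) (h0.mp hk)
    have e2 := hl (by decide) (h0'.mp hk)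
    omega
  · have e1 := hl (by decide) (h1.mp hk)
    have e2 := hl (by decide) (h1'.mp hk)
    omega
  · have e1 := hl (by decide) (h2.mp hk)
    have e2 := hl (by decide) (h2'.mp hk)
    omega

theorem exists_reduciblePoint_sq_eq_four {β : Fin 4 → ℂ} (h : β 0 * β 1 * β 2 * β 3 = 1)
    {i j : Fin 4} (hij : i ≠ j) (hi : β i ^ 2 = 1) (hj : β j ^ 2 = 1) :
    ∃ k, reduciblePoint β k ^ 2 = 4 := by
  obtain ⟨k, hk⟩ := exists_reduciblePoint_sq_eq_four_iff h hij
  exact ⟨k, hk.mpr (by rw [hi, hj, one_mul])⟩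

theorem exists_reduciblePoint_sq_ne_four {β : Fin 4 → ℂ} (h : β 0 * β 1 * β 2 * β 3 = 1)
    {i j : Fin 4} (he : ∀ k, β k ^ 2 = 1 ↔ k = i ∨ k = j) :
    ∃ k, reduciblePoint β k ^ 2 ≠ 4 := by
  obtain ⟨x, hxi, hxj⟩ : ∃ x : Fin 4, x ≠ i ∧ x ≠ j := by
    clear he
    revert i j
    decide
  obtain ⟨k, hk⟩ := exists_reduciblePoint_sq_eq_four_iff h hxi
  refine ⟨k, fun h4 => ?_⟩
  have := hk.mp h4
  rw [(he i).mpr (Or.inl rfl), mul_one, he] at this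
  exact this.elim hxi hxj

theorem hasSimpleSingularitiesOfType_of_mem (h : IsGenericPoint I κ) (h0 : (0 : Fin 5) ∈ I)
    (hI : I ≠ Finset.univ) :
    HasSimpleSingularitiesOfType (cubic (rh κ)) (subdiagram I) := by
  have hprod := h.eigenvalue_prod h0
  have hp : IsSingularPoint (cubic (rh κ)) (reduciblePoint (eigenvalue κ)) :=
    isSingularPoint_reduciblePoint (localMonodromy_eq κ) hprod
  have hu : ∀ q, IsSingularPoint (cubic (rh κ)) q → q = reduciblePoint (eigenvalue κ) :=
    fun q hq => h.eq_reduciblePoint h0 hq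
  have hhess := hessianForm_reduciblePoint_eq_zero_iff hprod
  obtain ⟨c0, c1, c2⟩ := reduciblePoint_sq_eq_four_iff hprod
  have hsq := sq_mul_sq_eq_one hprod
  have hcl := card_leaves h0
  have hc5 : I.card < 5 := by
    simpa using Finset.card_lt_card (Finset.ssubset_univ_iff.mpr hI)
  have hcases : I.card = 1 ∨ I.card = 2 ∨ I.card = 3 ∨ I.card = 4 := by omega
  have mk {T : ADE} {v : Fin T.rank} (hT : IsStar T.diagram v) (hc : I.card = T.rank)
      (hs : HasSimpleSingularityAt (cubic (rh κ)) (reduciblePoint (eigenvalue κ)) T) :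
      HasSimpleSingularitiesOfType (cubic (rh κ)) (subdiagram I) :=
    hasSimpleSingularitiesOfType_of_connected (subdiagram_connected h0)
      (nonempty_subdiagram_iso h0 hT hc) hp hu hs
  rcases hcases with hc | hc | hc | hc
  · refine mk isStar_A1 hc (hasSimpleSingularityAt_A1_of_hessianForm_ne_zero hp fun h' => ?_)
    obtain ⟨i, hi⟩ := hhess.mp h'
    rw [h.eigenvalue_sq_eq_one_iff_mem h0 (by omega)] at hi
    have := Finset.card_pos.mpr ⟨i, hi⟩
    omega
  · have he := h.eigenvalue_sq_eq_one_iff_mem h0 (by omega)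
    obtain ⟨i, hi⟩ := Finset.card_eq_one.mp (show (leaves I).card = 1 by omega)
    have he' : ∀ j, eigenvalue κ j ^ 2 = 1 ↔ j = i := by simpa [hi] using he
    clear he
    refine mk isStar_A2 hc (hasSimpleSingularityAt_A2 hp (hhess.mpr ⟨i, (he' i).mpr rfl⟩) ?_)
    exact reduciblePoint_sq_ne_four hprod he'
  · have he := h.eigenvalue_sq_eq_one_iff_mem h0 (by omega)
    obtain ⟨i, j, hij, hi⟩ := Finset.card_eq_two.mp (show (leaves I).card = 2 by omega)
    have he' : ∀ k, eigenvalue κ k ^ 2 = 1 ↔ k = i ∨ k = j := by simpa [hi] using he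
    clear he
    refine mk isStar_A3 hc
      (hasSimpleSingularityAt_A3 hp (hhess.mpr ⟨i, (he' i).mpr (Or.inl rfl)⟩) ?_ ?_)
    · exact exists_reduciblePoint_sq_eq_four hprod hij ((he' i).mpr (Or.inl rfl))
        ((he' j).mpr (Or.inr rfl))
    · exact exists_reduciblePoint_sq_ne_four hprod he'
  · have he (i : Fin 4) : eigenvalue κ i ^ 2 = 1 := by
      rw [h.eigenvalue_sq_eq_one_iff h0]
      by_contra! hne
      obtain ⟨hi, j, hji, hj⟩ := hne
      have hsub : leaves I ⊆ (Finset.univ.erase i).erase j := by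
        intro k hk
        have hk' : k.succ ∈ I := by simpa [leaves] using hk
        simp only [Finset.mem_erase, Finset.mem_univ, and_true]
        exact ⟨fun e => hj (e ▸ hk'), fun e => hi (e ▸ hk')⟩
      have h1 := Finset.card_le_card hsub
      rw [Finset.card_erase_of_mem (by simp [hji]), Finset.card_erase_of_mem (by simp)] at h1
      simp at h1
      omega
    refine mk isStar_D4 hc (hasSimpleSingularityAt_D4_of_forall hp (hhess.mpr ⟨0, he 0⟩) ?_)
    intro i
    fin_cases i
    · exact c0.mpr (by rw [he, he, one_mul])
    · exact c1.mpr (by rw [he, he, one_mul])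
    · exact c2.mpr (by rw [he, he, one_mul])

/-! ### Nonemptiness of the strata -/

theorem int_add_mul_sqrt_two_eq_zero {a b : ℤ} (h : (a : ℝ) + b * √2 = 0) : a = 0 ∧ b = 0 := by
  have hb : b = 0 := by
    by_contra hb
    refine irrational_sqrt_two ⟨-a / b, ?_⟩
    have hb' : (b : ℝ) ≠ 0 := by exact_mod_cast hb
    push_cast
    field_simp
    linear_combination -h
  subst hb
  simpa using h

/-- The numbers `1, √2, i, i√2` are linearly independent over the rationals. -/
theorem int_combination_eq_zero {a b c d : ℤ}
    (h : (a : ℂ) + b * (√2 : ℝ) + c * Complex.I + d * ((√2 : ℝ) * Complex.I) = 0) :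
    a = 0 ∧ b = 0 ∧ c = 0 ∧ d = 0 := by
  have hre := congrArg Complex.re h
  have him := congrArg Complex.im h
  simp at hre him
  have h1 := int_add_mul_sqrt_two_eq_zero hre
  have h2 := int_add_mul_sqrt_two_eq_zero him
  exact ⟨h1.1, h1.2, h2.1, h2.2⟩

/-- A point of a flat without further integral relations between its coordinates is generic. -/
theorem stratum_nonempty_of_independent {I : Finset (Fin 5)} {κ : Exponents} (hκ : κ ∈ flat I)
    (h : ∀ m : Fin 5 → ℤ, ∑ j, (m j : ℂ) * κ j = 0 → ∀ j, j ∉ I → m j = 0) :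
    (stratum I).Nonempty := by
  refine ⟨κ, 1, one_mem _, κ, hκ, fun H hH hκH => ?_, rfl⟩
  obtain ⟨m, rfl⟩ := hH.exists_eq_rootHyperplane
  intro κ' hκ'
  refine Finset.sum_eq_zero fun j _ => ?_
  by_cases hj : j ∈ I
  · rw [hκ' j hj, mul_zero]
  · rw [h m hκH j hj, Int.cast_zero, zero_mul]

/-- The exponent with the given coordinates at the nodes `0, 1, 2, 3`. -/
def exponentsOf (a b c d : ℂ) : Exponents :=
  ⟨![a, b, c, d, 1 - 2 * a - b - c - d], by simp⟩

theorem sum_mul_exponentsOf (m : Fin 5 → ℤ) (a b c d : ℂ) :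
    ∑ j, (m j : ℂ) * exponentsOf a b c d j = m 4 + (m 0 - 2 * m 4) * a + (m 1 - m 4) * b
      + (m 2 - m 4) * c + (m 3 - m 4) * d := by
  simp only [exponentsOf, Fin.sum_univ_five, Matrix.cons_val]
  ring

theorem stratum_nonempty_D4 : (stratum {0, 1, 2, 3}).Nonempty := by
  refine stratum_nonempty_of_independent (κ := exponentsOf 0 0 0 0) ?_ fun m hm => ?_
  · intro j hj
    fin_cases j <;> simp [exponentsOf] at hj ⊢
  · rw [sum_mul_exponentsOf] at hm
    obtain ⟨h1, -⟩ := int_combination_eq_zero (a := m 4) (b := 0) (c := 0) (d := 0)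
      (by rw [← hm]; push_cast; ring)
    intro j hj
    fin_cases j <;> simp at hj
    exact h1

theorem stratum_nonempty_A3 : (stratum {0, 1, 2}).Nonempty := by
  -- The affine relation fixes one free coordinate; the others here and below are distinct elements
  -- of `√2, i, i√2`, independent of 1 over the rationals.
  refine stratum_nonempty_of_independent (κ := exponentsOf 0 0 0 Complex.I) ?_ fun m hm => ?_
  · intro j hj
    fin_cases j <;> simp [exponentsOf] at hj ⊢
  · rw [sum_mul_exponentsOf] at hm
    obtain ⟨h1, -, h2, -⟩ := int_combination_eq_zero (a := m 4) (b := 0) (c := m 3 - m 4) (d := 0)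
      (by rw [← hm]; push_cast; ring)
    intro j hj
    fin_cases j <;> simp at hj ⊢ <;> omega

theorem stratum_nonempty_A2 : (stratum {0, 1}).Nonempty := by
  refine stratum_nonempty_of_independent (κ := exponentsOf 0 0 (√2 : ℝ) Complex.I) ?_
    fun m hm => ?_
  · intro j hj
    fin_cases j <;> simp [exponentsOf] at hj ⊢
  · rw [sum_mul_exponentsOf] at hm
    obtain ⟨h1, h2, h3, -⟩ := int_combination_eq_zero (a := m 4) (b := m 2 - m 4)
      (c := m 3 - m 4) (d := 0) (by rw [← hm]; push_cast; ring)
    intro j hj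
    fin_cases j <;> simp at hj ⊢ <;> omega

theorem stratum_nonempty_A1 : (stratum {0}).Nonempty := by
  refine stratum_nonempty_of_independent
    (κ := exponentsOf 0 ((√2 : ℝ) * Complex.I) (√2 : ℝ) Complex.I) ?_ fun m hm => ?_
  · intro j hj
    fin_cases j <;> simp [exponentsOf] at hj ⊢
  · rw [sum_mul_exponentsOf] at hm
    obtain ⟨h1, h2, h3, h4⟩ := int_combination_eq_zero (a := m 4) (b := m 2 - m 4)
      (c := m 3 - m 4) (d := m 1 - m 4) (by rw [← hm]; push_cast; ring)
    intro j hj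
    fin_cases j <;> simp at hj ⊢ <;> omega

theorem stratum_nonempty_four_A1 : (stratum {1, 2, 3, 4}).Nonempty := by
  refine stratum_nonempty_of_independent (κ := exponentsOf (1 / 2) 0 0 0) ?_ fun m hm => ?_
  · intro j hj
    fin_cases j <;> simp [exponentsOf] at hj ⊢
  · rw [sum_mul_exponentsOf] at hm
    -- With all leaves zero, `κ 0 = 1/2` is forced; doubling the relation clears this denominator.
    obtain ⟨h1, -⟩ := int_combination_eq_zero (a := m 0) (b := 0) (c := 0) (d := 0)
      (by push_cast; linear_combination 2 * hm)
    intro j hj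
    fin_cases j <;> simp at hj
    exact h1

theorem stratum_nonempty_three_A1 : (stratum {1, 2, 3}).Nonempty := by
  refine stratum_nonempty_of_independent (κ := exponentsOf Complex.I 0 0 0) ?_ fun m hm => ?_
  · intro j hj
    fin_cases j <;> simp [exponentsOf] at hj ⊢
  · rw [sum_mul_exponentsOf] at hm
    obtain ⟨h1, -, h2, -⟩ := int_combination_eq_zero (a := m 4) (b := 0) (c := m 0 - 2 * m 4)
      (d := 0) (by rw [← hm]; push_cast; ring)
    intro j hj
    fin_cases j <;> simp at hj ⊢ <;> omega

theorem stratum_nonempty_two_A1 : (stratum {1, 2}).Nonempty := by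
  refine stratum_nonempty_of_independent (κ := exponentsOf Complex.I 0 0 (√2 : ℝ)) ?_
    fun m hm => ?_
  · intro j hj
    fin_cases j <;> simp [exponentsOf] at hj ⊢
  · rw [sum_mul_exponentsOf] at hm
    obtain ⟨h1, h3, h2, -⟩ := int_combination_eq_zero (a := m 4) (b := m 3 - m 4)
      (c := m 0 - 2 * m 4) (d := 0) (by rw [← hm]; push_cast; ring)
    intro j hj
    fin_cases j <;> simp at hj ⊢ <;> omega

theorem exists_stratum_of_possibleTypes {l : List ADE} (hl : l ∈ possibleTypes) :
    ∃ I : Finset (Fin 5), I.Nonempty ∧ I ≠ Finset.univ ∧ (stratum I).Nonempty ∧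
      HasDynkinType (subdiagram I) l := by
  have hne {I : Finset (Fin 5)} (i : Fin 5) (hi : i ∉ I) : I ≠ Finset.univ := by
    rintro rfl; simp at hi
  simp only [possibleTypes, List.mem_cons, List.not_mem_nil, or_false] at hl
  rcases hl with rfl | rfl | rfl | rfl | rfl | rfl | rfl
  · exact ⟨{0, 1, 2, 3}, by simp, hne 4 (by decide), stratum_nonempty_D4,
      hasDynkinType_subdiagram_of_mem (by simp) isStar_D4 rfl⟩
  · exact ⟨{0, 1, 2}, by simp, hne 4 (by decide), stratum_nonempty_A3,
      hasDynkinType_subdiagram_of_mem (by simp) isStar_A3 rfl⟩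
  · exact ⟨{0, 1}, by simp, hne 4 (by decide), stratum_nonempty_A2,
      hasDynkinType_subdiagram_of_mem (by simp) isStar_A2 rfl⟩
  · exact ⟨{0}, by simp, hne 4 (by decide), stratum_nonempty_A1,
      hasDynkinType_subdiagram_of_mem (by simp) isStar_A1 rfl⟩
  · exact ⟨{1, 2, 3, 4}, by simp, hne 0 (by decide), stratum_nonempty_four_A1,
      hasDynkinType_subdiagram_of_notMem (by decide) rfl⟩
  · exact ⟨{1, 2, 3}, by simp, hne 0 (by decide), stratum_nonempty_three_A1,
      hasDynkinType_subdiagram_of_notMem (by decide) rfl⟩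
  · exact ⟨{1, 2}, by simp, hne 0 (by decide), stratum_nonempty_two_A1,
      hasDynkinType_subdiagram_of_notMem (by decide) rfl⟩

/-- The surface of a point of a stratum has the singularities of the corresponding diagram. -/
theorem hasSimpleSingularitiesOfType_of_mem_stratum {I : Finset (Fin 5)} (hI : I ≠ Finset.univ)
    {κ : Exponents} (hκ : κ ∈ stratum I) :
    HasSimpleSingularitiesOfType (cubic (rh κ)) (subdiagram I) := by
  obtain ⟨w, hw, κ', hκ', hgen, rfl⟩ := hκ
  rw [rh_apply_of_mem hw]
  by_cases h0 : (0 : Fin 5) ∈ I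
  · exact hasSimpleSingularitiesOfType_of_mem ⟨hκ', hgen⟩ h0 hI
  · exact hasSimpleSingularitiesOfType_of_notMem ⟨hκ', hgen⟩ h0

end PainleveVI

theorem theorem9p4 :
    (∀ I : Finset (Fin 5), I.Nonempty → I ≠ Finset.univ → ∀ κ ∈ PainleveVI.stratum I,
      PainleveVI.HasSimpleSingularitiesOfType
        (PainleveVI.cubic (PainleveVI.rh κ)) (PainleveVI.subdiagram I)) ∧
    (∀ I : Finset (Fin 5), I.Nonempty → I ≠ Finset.univ →
      ∃ l ∈ PainleveVI.possibleTypes, PainleveVI.HasDynkinType (PainleveVI.subdiagram I) l) ∧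
    (∀ l ∈ PainleveVI.possibleTypes, ∃ I : Finset (Fin 5), I.Nonempty ∧ I ≠ Finset.univ ∧
      (PainleveVI.stratum I).Nonempty ∧
      PainleveVI.HasDynkinType (PainleveVI.subdiagram I) l) :=
  ⟨fun _ _ hI _ hκ => PainleveVI.hasSimpleSingularitiesOfType_of_mem_stratum hI hκ,
    fun _ hI hI' => PainleveVI.exists_hasDynkinType_subdiagram hI hI',
    fun _ hl => PainleveVI.exists_stratum_of_possibleTypes hl⟩
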